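/- **Setting.** Let $\mathcal X,\mathcal V$ be finite sets, $N\ge 2$, and let $p$ be a probability distribution on $\mathcal X$, $\pi_1,\dots,\pi_N$ experts (conditional distributions $\pi_i(\cdot|x)$ on $\mathcal V$), and $q(\cdot|x,v)$ reward distributions on $[0,1]$. Let $\mu_i$ be the mean reward of expert $i$ under $p(x)\pi_i(v|x)q(dy|x,v)$. Assume $0<p_X\le p(x)$, $0<p_V\le \pi_i(v|x)$, $0<\gamma\le\mu_i$ for all $i,x,v$, and $\mu_1>\mu_2\ge\dots\ge\mu_N$; put $\Delta_i=\mu_1-\mu_i$ and assume $\Delta_2>\gamma p_V$. Let $f_1(x)=xe^{x-1}-1$, $M_{ij}=1+\log\bigl(1+\sum_x p(x)\sum_v\pi_i(v|x)f_1(\pi_i(v|x)/\pi_j(v|x))\bigr)$, let $M$ be any upper bound on all $M_{ij}$, $C=\frac{32M}{\gamma(1-p_V)}$, and for $x>0$ let $w(x)$ be the $y\in(0,2)$ with $y/\log(2/y)=x$ (and $w(0)=0$). **Algorithm.** Given estimates $\hat\pi_i(v|x)$, put $\hat r_{ij}=\hat\pi_i/\hat\pi_j$, $\underline r_{ij}=\hat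 r_{ij}-\frac{\xi}{p_V(p_V-\xi)}$, $\overline r_{ij}=\hat r_{ij}+\frac{\xi}{p_V(p_V+\xi)}$ and $\underline M_{ij}=1+\log\bigl(1+p_X\sum_{x,v}(\hat\pi_i(v|x)-\xi)f_1(\underline r_{ij}(v|x))\bigr)$. If experts $k_1,\dots,k_t$ were played, contexts $X_s$ and actions $V_s$ were observed and rewards $Y_s$ received, let $Z_i(t)=\sum_{s\le t}\underline M_{ik_s}^{-1}$, $\epsilon_i(t)=C\,w\bigl(\sqrt{t\log t}/Z_i(t)\bigr)$, and let $I_{ij,t}(x,v)$ be the indicator of $\overline r_{ij}(v|x)\le 2\log(2/\epsilon_i(t))\,\underline M_{ij}$. Let $$\tilde Y_i(t)=\frac1{Z_i(t)}\sum_{s\le t}\frac{Y_s}{\underline M_{ik_s}}\,\underline r_{ik_s}(V_s|X_s)\,I_{ik_s,t}(X_s,V_s),\qquad e_i(t)=\max_{x,v,j}\bigl(\overline r_{ij}(v|x)-\underline r_{ij}(v|x)I_{ij,t}(x,v)\bigr),$$ $U_i(t)=\tilde Y_i(t)+\frac32\epsilon_i(t)+e_i(t)$. ED-UCB plays an arbitrary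 expert in round $1$ and $k_{t+1}\in\arg\max_iU_i(t)$ in round $t+1$, ties being broken without use of the new context; then $X_{t+1}\sim p$, $V_{t+1}\sim\pi_{k_{t+1}}(\cdot|X_{t+1})$, $Y_{t+1}\sim q(\cdot|X_{t+1},V_{t+1})$. **Times.** $T_{clip}$ is the least $t\ge2$ such that $\overline r_{ij}(v|x)\le2\log(2/\epsilon_i(t))\underline M_{ij}$ for all $i,j,x,v$ and every possible sequence $k_1,\dots,k_t$ of experts played; $\tau_1=\min\{t\ge2: C\,w(\sqrt{\log t/t})\le\gamma\}$; for $k\ge2$, $\tau_k=\min\bigl\{t\ge2:\frac t{\log t}\ge\frac{9C^2M^2\log^2(6C/(\Delta_k-\gamma p_V))}{(\Delta_k-\gamma p_V)^2}\bigr\}$; $T_1=\max\{T_{clip},\tau_1\}$, $T_k=\max\{T_1,\tau_k\}$. **Theorem 2.** Let $\hat\pi$ be random $(\xi,\delta)$-approximate experts: with probability at least $1-\delta$, $|\pi_i(v|x)-\hat\pi_i(v|x)|\le\xi$ for all $i,x,v$. Suppose that $$\xi\le 2\,\frac{\sqrt{1+p_V^4\gamma^2}-1}{p_V\gamma}\qquad\text{and}\qquad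 \frac{\xi}{p_V}\Bigl(\frac1{p_V-\xi}+\frac1{p_V+\xi}\Bigr)\le\frac{\gamma p_V}{2}.$$ Then, with probability at least $1-\delta$ over $\hat\pi$, the times above all exist and, for every $T\ge T_2$, the expected cumulative regret of ED-UCB run with $\hat\pi$ (the expectation being over the interaction, which is independent of how $\hat\pi$ was drawn) satisfies $$\mathbb E\Bigl[\sum_{t=1}^T(\mu_1-\mu_{k_t})\Bigr]\le R(\mathbf\Delta):=\frac{\pi^2}{3}\sum_{k=2}^N\Delta_k+T_N\Delta_N+\sum_{k=2}^{N-1}(T_k-T_{k+1})\Delta_k .$$ Moreover $R(\mathbf\Delta)\le C_1N$ with a constant $C_1$ that depends only on $p_X,p_V,\gamma,M,\Delta_2$ (in particular not on $T$, $N$ or $\delta$). -/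

import Mathlib

open MeasureTheory Finset

universe u v w z

noncomputable section

namespace EDUCB

/-- A single-episode contextual bandit with `N` stochastic experts, finite context set `X` and finite
action set `V`: the context law `p`, the expert policies `π_i(v|x)`, and the laws `q(·|x,v)` of the
rewards, which lie in `[0,1]`. -/
structure Environment (N : ℕ) (X : Type u) (V : Type v) [Fintype X] [Fintype V] where
  ctxLaw : X → ℝ
  ctxLaw_nonneg : ∀ x, 0 ≤ ctxLaw x
  ctxLaw_sum : ∑ x, ctxLaw x = 1
  policy : Fin N → X → V → ℝ
  policy_nonneg : ∀ i x a, 0 ≤ policy i x a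
  policy_sum : ∀ i x, ∑ a, policy i x a = 1
  rewardLaw : X → V → Measure ℝ
  rewardLaw_prob : ∀ x a, IsProbabilityMeasure (rewardLaw x a)
  rewardLaw_unit : ∀ x a, rewardLaw x a (Set.Icc 0 1) = 1

/-- The function `f₁(x) = x exp(x - 1) - 1` generating the divergence. -/
def f₁ (x : ℝ) : ℝ := x * Real.exp (x - 1) - 1

/-- `w(x)` is the number `y ∈ (0,2)` with `y / log(2/y) = x`; it exists (and is unique) for every
`x > 0`. By continuity `w(0) = 0`. -/
def w (x : ℝ) : ℝ :=
  open Classical in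
  if h : ∃ y : ℝ, 0 < y ∧ y < 2 ∧ y / Real.log (2 / y) = x then h.choose else 0

namespace Environment

variable {N : ℕ} {X : Type u} {V : Type v} [Fintype X] [Fintype V]

/-- Mean reward `μ_i` of expert `i`. -/
def mean (E : Environment N X V) (i : Fin N) : ℝ :=
  ∑ x, E.ctxLaw x * ∑ a, E.policy i x a * ∫ y, y ∂(E.rewardLaw x a)

/-- The true divergence `D_{f₁}(i‖j)`. -/
def trueD (E : Environment N X V) (i j : Fin N) : ℝ :=
  ∑ x, E.ctxLaw x * ∑ a, E.policy i x a * f₁ (E.policy i x a / E.policy j x a)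

/-- `M_{ij} = 1 + log(1 + D_{f₁}(i‖j))`. -/
def trueM (E : Environment N X V) (i j : Fin N) : ℝ :=
  1 + Real.log (1 + E.trueD i j)

/-- Suboptimality gap `Δ_i = μ_1 - μ_i`; the first expert is index `0`. -/
def gap {m : ℕ} (E : Environment (m + 2) X V) (i : Fin (m + 2)) : ℝ := E.mean 0 - E.mean i

end Environment

/-- The numerical inputs: the lower bounds `p_X`, `p_V`, `γ`, the accuracy `ξ` of the approximate
experts, and an upper bound `M` on the divergences `M_{ij}`. -/
structure Params where
  pX : ℝ
  pV : ℝ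
  γ : ℝ
  ξ : ℝ
  M : ℝ

/-- `C = 32 M / (γ (1 - p_V))`. -/
def Params.C (P : Params) : ℝ := 32 * P.M / (P.γ * (1 - P.pV))

section Algorithm

variable {N : ℕ} {X : Type u} {V : Type v} [Fintype X] [Fintype V]

/-- `\hat r_{ij}(v|x)`, from the approximate experts `πh`. -/
def rHat (πh : Fin N → X → V → ℝ) (i j : Fin N) (x : X) (a : V) : ℝ := πh i x a / πh j x a

/-- Lower confidence value of the importance sampling ratio. -/
def rLow (P : Params) (πh : Fin N → X → V → ℝ) (i j : Fin N) (x : X) (a : V) : ℝ :=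
  rHat πh i j x a - P.ξ / (P.pV * (P.pV - P.ξ))

/-- Upper confidence value of the importance sampling ratio. -/
def rUp (P : Params) (πh : Fin N → X → V → ℝ) (i j : Fin N) (x : X) (a : V) : ℝ :=
  rHat πh i j x a + P.ξ / (P.pV * (P.pV + P.ξ))

/-- The divergence estimate `\underline D_{f₁}(i‖j)`. -/
def estD (P : Params) (πh : Fin N → X → V → ℝ) (i j : Fin N) : ℝ :=
  P.pX * ∑ x, ∑ a, (πh i x a - P.ξ) * f₁ (rLow P πh i j x a)

/-- `\underline M_{ij} = 1 + log(1 + \underline D_{f₁}(i‖j))`. -/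
def estM (P : Params) (πh : Fin N → X → V → ℝ) (i j : Fin N) : ℝ :=
  1 + Real.log (1 + estD P πh i j)

/-- `Z_i(t) = ∑_{s=1}^t 1 / \underline M_{i k_s}`, along the sequence `k` of experts played. -/
def Z (P : Params) (πh : Fin N → X → V → ℝ) (k : ℕ → Fin N) (i : Fin N) (t : ℕ) : ℝ :=
  ∑ s ∈ Icc 1 t, (estM P πh i (k s))⁻¹

/-- `ε_i(t) = C w(√(t log t) / Z_i(t))`. -/
def eps (P : Params) (πh : Fin N → X → V → ℝ) (k : ℕ → Fin N) (i : Fin N) (t : ℕ) : ℝ :=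
  P.C * w (√(t * Real.log t) / Z P πh k i t)

/-- The ratio of experts `i`, `j` at `(x,v)` passes the clipper of expert `i` at time `t`:
`\overline r_{ij}(v|x) ≤ 2 log(2/ε_i(t)) \underline M_{ij}`. When `ε_i(t) = 0` (this happens at
`t = 1`, where `log t = 0`) the clipper level is infinite. -/
def Passes (P : Params) (πh : Fin N → X → V → ℝ) (k : ℕ → Fin N) (i : Fin N) (t : ℕ)
    (j : Fin N) (x : X) (a : V) : Prop :=
  eps P πh k i t = 0 ∨
    rUp P πh i j x a ≤ 2 * Real.log (2 / eps P πh k i t) * estM P πh i j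

open Classical in
/-- The clipped importance sampling estimator `\tilde Y_i(t)`, along a trajectory of experts `k`,
contexts `cx`, actions `av` and rewards `y`. -/
def estY (P : Params) (πh : Fin N → X → V → ℝ) (k : ℕ → Fin N) (cx : ℕ → X) (av : ℕ → V)
    (y : ℕ → ℝ) (i : Fin N) (t : ℕ) : ℝ :=
  (Z P πh k i t)⁻¹ * ∑ s ∈ Icc 1 t, y s / estM P πh i (k s) * rLow P πh i (k s) (cx s) (av s) *
    (if Passes P πh k i t (k s) (cx s) (av s) then 1 else 0)

open Classical in
/-- The maximal estimation error `e_i(t)`. -/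
def err (P : Params) (πh : Fin N → X → V → ℝ) (k : ℕ → Fin N) (i : Fin N) (t : ℕ) : ℝ :=
  ⨆ q : Fin N × X × V, (rUp P πh i q.1 q.2.1 q.2.2 - rLow P πh i q.1 q.2.1 q.2.2 *
    (if Passes P πh k i t q.1 q.2.1 q.2.2 then 1 else 0))

/-- The index `U_i(t) = \tilde Y_i(t) + (3/2) ε_i(t) + e_i(t)`, for `t ≥ 1`. -/
def ucb (P : Params) (πh : Fin N → X → V → ℝ) (k : ℕ → Fin N) (cx : ℕ → X) (av : ℕ → V)
    (y : ℕ → ℝ) (i : Fin N) (t : ℕ) : ℝ :=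
  estY P πh k cx av y i t + 3 / 2 * eps P πh k i t + err P πh k i t

/-- A run of ED-UCB, fed with the approximate experts `πh`, in the environment `E`. The rounds are
`1, 2, 3, …`; `ℱ t` is the information available after round `t` (it may contain extra randomness
that is used to break ties). In round `t + 1` the expert maximizes the current index `U_i(t)` (any
expert may be played in round `1`, as `U_i(0) = ∞` for all `i`); then, conditionally on the past,
the context, action and reward have the law `p(x) π_{k_{t+1}}(v|x) q(dy|x,v)`. -/
structure IsRun (E : Environment N X V) (P : Params) (πh : Fin N → X → V → ℝ)
    {Ω : Type z} [mΩ : MeasurableSpace Ω] (μ : Measure Ω) (ℱ : Filtration ℕ mΩ)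
    (k : ℕ → Ω → Fin N) (cx : ℕ → Ω → X) (av : ℕ → Ω → V) (y : ℕ → Ω → ℝ) : Prop where
  expert_predictable : ∀ t i, MeasurableSet[ℱ t] {ω | k (t + 1) ω = i}
  context_adapted : ∀ t x, MeasurableSet[ℱ (t + 1)] {ω | cx (t + 1) ω = x}
  action_adapted : ∀ t a, MeasurableSet[ℱ (t + 1)] {ω | av (t + 1) ω = a}
  reward_adapted : ∀ t, Measurable[ℱ (t + 1)] (y (t + 1))
  expert_argmax : ∀ t, 1 ≤ t → ∀ ω i,
    ucb P πh (fun s => k s ω) (fun s => cx s ω) (fun s => av s ω) (fun s => y s ω) i t ≤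
      ucb P πh (fun s => k s ω) (fun s => cx s ω) (fun s => av s ω) (fun s => y s ω)
        (k (t + 1) ω) t
  law : ∀ t x a (B : Set ℝ), MeasurableSet B →
    condExp (ℱ t) μ
        (Set.indicator {ω | cx (t + 1) ω = x ∧ av (t + 1) ω = a ∧ y (t + 1) ω ∈ B}
          (fun _ => (1 : ℝ)))
      =ᵐ[μ] fun ω =>
        E.ctxLaw x * E.policy (k (t + 1) ω) x a * (E.rewardLaw x a).real B

/-- `(ξ,δ)`-approximate experts: with probability at least `1 - δ` all the estimated policies are
within `ξ` of the true ones in the supremum norm. -/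
def IsApproxExperts (E : Environment N X V) (ξ δ : ℝ) {Ω₀ : Type w} [MeasurableSpace Ω₀]
    (P₀ : Measure Ω₀) (πh : Ω₀ → Fin N → X → V → ℝ) : Prop :=
  ENNReal.ofReal (1 - δ) ≤ P₀ {ω | ∀ i x a, |E.policy i x a - πh ω i x a| ≤ ξ}

/-- The times at which all clippers are passed, whatever experts have been played so far. Times
start at `2`, where `log t > 0`. -/
def clipTimes (P : Params) (πh : Fin N → X → V → ℝ) : Set ℕ :=
  {t | 2 ≤ t ∧ ∀ (k : ℕ → Fin N) (i j : Fin N) (x : X) (a : V), Passes P πh k i t j x a}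

/-- The times in the definition of `τ_1`. -/
def tau1Times (P : Params) : Set ℕ :=
  {t | 2 ≤ t ∧ P.C * w (√(Real.log t / t)) ≤ P.γ}

/-- The times in the definition of `τ_k`, for an expert with gap `Δ`. -/
def tauTimes (P : Params) (Δ : ℝ) : Set ℕ :=
  {t | 2 ≤ t ∧
    9 * P.C ^ 2 * P.M ^ 2 * Real.log (6 * P.C / (Δ - P.γ * P.pV)) ^ 2 / (Δ - P.γ * P.pV) ^ 2
      ≤ t / Real.log t}

/-- `T_1 = max{T_clip, τ_1}`. -/
def T₁ (P : Params) (πh : Fin N → X → V → ℝ) : ℕ :=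
  max (sInf (clipTimes P πh)) (sInf (tau1Times P))

/-- `T_k = max{T_1, τ_k}`, for a suboptimal expert with gap `Δ`. -/
def Tsub (P : Params) (πh : Fin N → X → V → ℝ) (Δ : ℝ) : ℕ :=
  max (T₁ P πh) (sInf (tauTimes P Δ))

end Algorithm

/-- With `N = m + 2` experts (the `k`-th expert is index `k - 1`):
`(π²/3) ∑_{k=2}^N Δ_k + T_N Δ_N + ∑_{k=2}^{N-1} (T_k - T_{k+1}) Δ_k`. -/
def regretBound {m : ℕ} (Δ : Fin (m + 2) → ℝ) (T : Fin (m + 2) → ℕ) : ℝ :=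
  Real.pi ^ 2 / 3 * ∑ k : Fin (m + 1), Δ k.succ
    + T (Fin.last (m + 1)) * Δ (Fin.last (m + 1))
    + ∑ k : Fin m, ((T k.succ.castSucc : ℝ) - T k.succ.succ) * Δ k.succ.castSucc

end EDUCB

end

/-! ### The function `w`, the decay of `log t / t`, and elementary bounds for `f₁`. -/

noncomputable section

namespace EDUCB

/-! The proof is a UCB argument on the event that the approximate experts are `ξ`-accurate. There
the assumptions on `ξ` force `ξ ≤ pV / 16`, so every true ratio lies in its confidence interval, of
common width at most `γ pV / 2`, and `estM` lies between `1 / 8` and `9 / 8 * M`.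

Once all clippers are passed, the estimator is a weighted average of bounded terms whose conditional
means lie in `[μ_i - width, μ_i]`. Azuma–Hoeffding (`measure_deviation_le`) bounds by `t⁻²` the
probability that its centred numerator deviates by `8 √(t log t)` times the largest normalized
ratio. Passing the clippers bounds that ratio by `2 log(2/ε)`, and the defining equation of `w`
turns the product into at most `ε Z / 2` (`maxRatio_mul_le`). Hence, off two events of probability
`t⁻²`, the best index exceeds `μ_1` and that of expert `j` is below `μ_j + 2ε + width`. After `τ_j`
the latter is less than `μ_1`, so `j` is played with probability at most `2 / t²`
(`measure_expert_le`); summing over `t` gives `π² / 3`.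

Rounds before these times are charged by layers: the `T_k` decrease as the gaps grow, so a round `t`
costs at most the largest gap with `T_k ≥ t`, and Abel summation yields the remaining terms of
`regretBound`.

For linearity in `N`, every defining condition of the times is reduced to an upper bound on `√(log t
/ t)` by a function of the parameters, so one `t₀` bounds all the `T_k`; the layers then telescope
to at most `t₀`. -/

theorem log_two_div_pos {y : ℝ} (hy : 0 < y) (hy2 : y < 2) : 0 < Real.log (2 / y) :=
  Real.log_pos ((one_lt_div hy).2 hy2)

theorem exists_div_log_eq {x : ℝ} (hx : 0 < x) :
    ∃ y : ℝ, 0 < y ∧ y < 2 ∧ y / Real.log (2 / y) = x := by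
  -- Chosen so that `log(2/y₀) = 2/x + 1`; then `y - x log(2/y)` equals `y₀ - 2 - x < 0` at `y₀`,
  -- and it is `2` at `2`.
  set y₀ : ℝ := 2 * Real.exp (-(2 / x + 1)) with hy₀
  have hy₀pos : 0 < y₀ := by positivity
  have hy₀lt : y₀ < 2 := by
    have : Real.exp (-(2 / x + 1)) < 1 := by
      have h0 : -(2 / x + 1) < 0 := by have := div_pos two_pos hx; linarith
      simpa using Real.exp_lt_exp.2 h0
    linarith
  have hlog : Real.log (2 / y₀) = 2 / x + 1 := by
    rw [hy₀, div_mul_eq_div_div, div_self two_ne_zero, one_div, ← Real.exp_neg, neg_neg,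
      Real.log_exp]
  have hcont : ContinuousOn (fun y : ℝ => y - x * Real.log (2 / y)) (Set.Icc y₀ 2) := by
    refine continuousOn_id.sub (continuousOn_const.mul (ContinuousOn.log ?_ ?_))
    · exact continuousOn_const.div continuousOn_id fun y hy => (hy₀pos.trans_le hy.1).ne'
    · exact fun y hy => (div_pos two_pos (hy₀pos.trans_le hy.1)).ne'
  have hleft : y₀ - x * Real.log (2 / y₀) < 0 := by
    have : x * (2 / x + 1) = 2 + x := by field_simp
    rw [hlog, this]; linarith
  obtain ⟨y, hy, hyx⟩ := intermediate_value_Icc hy₀lt.le hcont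
    ⟨hleft.le, (by norm_num : (0 : ℝ) ≤ 2 - x * Real.log (2 / 2))⟩
  have hypos : 0 < y := hy₀pos.trans_le hy.1
  have hyx : y - x * Real.log (2 / y) = 0 := hyx
  have hy2 : y < 2 := by
    refine lt_of_le_of_ne hy.2 ?_
    rintro rfl
    norm_num at hyx
  refine ⟨y, hypos, hy2, ?_⟩
  rw [div_eq_iff (log_two_div_pos hypos hy2).ne']
  linarith

theorem w_spec {x : ℝ} (hx : 0 < x) :
    0 < w x ∧ w x < 2 ∧ w x / Real.log (2 / w x) = x := by
  have h := exists_div_log_eq hx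
  rw [w, dif_pos h]
  exact h.choose_spec

/-- The numerator grows while `log(2/y)` decreases. This monotonicity makes `w` an increasing
inverse, so bounds on `w` become bounds on its argument. -/
theorem div_log_lt {y y' : ℝ} (hy : 0 < y) (hyy : y < y') (hy' : y' < 2) :
    y / Real.log (2 / y) < y' / Real.log (2 / y') := by
  have h' := log_two_div_pos (hy.trans hyy) hy'
  have hle : Real.log (2 / y') ≤ Real.log (2 / y) :=
    Real.log_le_log (by have := hy.trans hyy; positivity) (by gcongr)
  calc y / Real.log (2 / y) ≤ y / Real.log (2 / y') := by gcongr
    _ < y' / Real.log (2 / y') := by gcongr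

theorem w_le {x y : ℝ} (hx : 0 < x) (hy : 0 < y)
    (h : x ≤ y / Real.log (2 / y)) : w x ≤ y := by
  obtain ⟨-, h2, h3⟩ := w_spec hx
  by_contra! hlt
  have := div_log_lt hy hlt h2
  linarith

theorem le_of_w_le {x y : ℝ} (hx : 0 < x) (hy2 : y < 2)
    (h : w x ≤ y) : x ≤ y / Real.log (2 / y) := by
  obtain ⟨h1, h2, h3⟩ := w_spec hx
  rcases h.eq_or_lt with h | h
  · rw [← h, h3]
  · rw [← h3]; exact (div_log_lt h1 h hy2).le

theorem w_mono {x x' : ℝ} (hx : 0 < x) (h : x ≤ x') : w x ≤ w x' := by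
  obtain ⟨h1, h2, h3⟩ := w_spec (hx.trans_le h)
  exact w_le hx h1 (by rwa [h3])

/-- `log x / x` decreases only from `e` on, but `log 2 / 2 = log 4 / 4`, so starting at `s = 2`
costs only the exclusion of `t = 3`. Hence the recurring condition `4 ≤ t`. -/
theorem log_div_nat_le {s t : ℕ} (hs : 2 ≤ s) (hst : s ≤ t) (ht : 4 ≤ t) :
    Real.log t / t ≤ Real.log s / s := by
  have key : ∀ a b : ℕ, 3 ≤ a → a ≤ b → Real.log b / b ≤ Real.log a / a := by
    intro a b ha hab
    have h3 : Real.exp 1 ≤ a := by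
      have : (3 : ℝ) ≤ a := by exact_mod_cast ha
      linarith [Real.exp_one_lt_d9]
    have hab' : (a : ℝ) ≤ b := by exact_mod_cast hab
    exact Real.log_div_self_antitoneOn h3 (h3.trans hab') hab'
  rcases hs.eq_or_lt with rfl | hs
  · refine (key 4 t (by norm_num) ht).trans_eq ?_
    have : Real.log ((4 : ℕ) : ℝ) = 2 * Real.log 2 := by
      rw [show ((4 : ℕ) : ℝ) = 2 ^ 2 by norm_num, Real.log_pow]; norm_num
    rw [this]; push_cast; ring
  · exact key s t hs hst

theorem sqrt_log_div_pos {t : ℕ} (ht : 2 ≤ t) : 0 < √(Real.log t / t) := by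
  have h : (1 : ℝ) < t := by exact_mod_cast ht
  have := Real.log_pos h
  positivity

theorem sqrt_mul_log_eq (t : ℕ) : √(t * Real.log t) = t * √(Real.log t / t) := by
  rcases Nat.eq_zero_or_pos t with rfl | ht
  · simp
  have h : (0 : ℝ) < t := by exact_mod_cast ht
  rw [show (t : ℝ) * Real.log t = t ^ 2 * (Real.log t / t) by field_simp,
    Real.sqrt_mul (by positivity), Real.sqrt_sq h.le]

theorem sqrt_log_div_le_one (t : ℕ) : √(Real.log t / t) ≤ 1 := by
  rw [Real.sqrt_le_one]
  rcases Nat.eq_zero_or_pos t with rfl | ht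
  · simp
  have h : (0 : ℝ) < t := by exact_mod_cast ht
  rw [div_le_one h]
  linarith [Real.log_le_sub_one_of_pos h]

theorem exists_sqrt_log_div_le {κ : ℝ} (hκ : 0 < κ) :
    ∃ t : ℕ, 4 ≤ t ∧ √(Real.log t / t) ≤ κ := by
  have h : Filter.Tendsto (fun t : ℕ => Real.log (t : ℝ) / t) Filter.atTop (nhds 0) :=
    (Real.isLittleO_log_id_atTop.tendsto_div_nhds_zero).comp tendsto_natCast_atTop_atTop
  have h' := (h.eventually (gt_mem_nhds (pow_pos hκ 2))).and (Filter.eventually_ge_atTop 4)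
  obtain ⟨t, ht, ht4⟩ := h'.exists
  exact ⟨t, ht4, (Real.sqrt_le_left hκ.le).2 ht.le⟩

/-- From `exp(x - 1) ≥ x` and `x² ≥ 2x - 1`. It gives `f₁ r ≥ 2r - 2`, which compares the
`f₁`-divergence with the chi-square divergence. -/
theorem two_mul_sub_one_le_mul_exp {x : ℝ} (hx : 0 ≤ x) : 2 * x - 1 ≤ x * Real.exp (x - 1) := by
  have h : x ≤ Real.exp (x - 1) := by linarith [Real.add_one_le_exp (x - 1)]
  nlinarith [mul_le_mul_of_nonneg_left h hx, sq_nonneg (x - 1)]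

theorem mul_exp_mono {x y : ℝ} (hx : 0 ≤ x) (hxy : x ≤ y) :
    x * Real.exp (x - 1) ≤ y * Real.exp (y - 1) := by
  have hy := hx.trans hxy
  gcongr

end EDUCB
end

/-! ### Expectations under an expert; confidence bounds for ratios and divergences. -/

noncomputable section

namespace EDUCB

variable {N : ℕ} {X : Type u} {V : Type v} [Fintype X] [Fintype V]

/-- Mean reward of action `a` in context `x`. -/
def Environment.rewardMean (E : Environment N X V) (x : X) (a : V) : ℝ := ∫ y, y ∂(E.rewardLaw x a)

namespace Environment

theorem rewardLaw_ae_mem (E : Environment N X V) (x : X) (a : V) :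
    ∀ᵐ y ∂(E.rewardLaw x a), y ∈ Set.Icc (0 : ℝ) 1 := by
  have := E.rewardLaw_prob x a
  exact (mem_ae_iff_prob_eq_one measurableSet_Icc).2 (E.rewardLaw_unit x a)

theorem rewardLaw_integrable_id (E : Environment N X V) (x : X) (a : V) :
    Integrable (fun y => y) (E.rewardLaw x a) := by
  have := E.rewardLaw_prob x a
  refine Integrable.of_bound measurable_id.aestronglyMeasurable 1 ?_
  filter_upwards [E.rewardLaw_ae_mem x a] with y hy
  rw [Real.norm_eq_abs, abs_of_nonneg hy.1]
  exact hy.2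

theorem rewardMean_nonneg (E : Environment N X V) (x : X) (a : V) : 0 ≤ E.rewardMean x a :=
  integral_nonneg_of_ae (by filter_upwards [E.rewardLaw_ae_mem x a] with y hy using hy.1)

theorem rewardMean_le_one (E : Environment N X V) (x : X) (a : V) : E.rewardMean x a ≤ 1 := by
  have := E.rewardLaw_prob x a
  calc E.rewardMean x a ≤ ∫ _, (1 : ℝ) ∂(E.rewardLaw x a) := by
        refine integral_mono_ae (E.rewardLaw_integrable_id x a) (integrable_const _) ?_
        filter_upwards [E.rewardLaw_ae_mem x a] with y hy using hy.2
    _ = 1 := by simp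

/-- Expectation of a function of context and action under expert `j`. -/
def expect (E : Environment N X V) (j : Fin N) (f : X → V → ℝ) : ℝ :=
  ∑ x, E.ctxLaw x * ∑ a, E.policy j x a * f x a

theorem expect_mono (E : Environment N X V) (j : Fin N) {f g : X → V → ℝ}
    (h : ∀ x a, f x a ≤ g x a) : E.expect j f ≤ E.expect j g := by
  unfold expect
  gcongr with x _ a _
  · exact E.ctxLaw_nonneg x
  · exact E.policy_nonneg j x a
  · exact h x a

theorem expect_const (E : Environment N X V) (j : Fin N) (c : ℝ) :
    E.expect j (fun _ _ => c) = c := by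
  simp only [expect, ← Finset.sum_mul, E.policy_sum, one_mul, E.ctxLaw_sum]

theorem expect_sub (E : Environment N X V) (j : Fin N) (f g : X → V → ℝ) :
    E.expect j (fun x a => f x a - g x a) = E.expect j f - E.expect j g := by
  simp only [expect, mul_sub, Finset.sum_sub_distrib]

theorem mean_eq_expect (E : Environment N X V) (i : Fin N) : E.mean i = E.expect i E.rewardMean :=
  rfl

theorem mean_nonneg (E : Environment N X V) (i : Fin N) : 0 ≤ E.mean i := by
  rw [mean_eq_expect, ← E.expect_const i 0]
  exact E.expect_mono i fun x a => E.rewardMean_nonneg x a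

theorem mean_le_one (E : Environment N X V) (i : Fin N) : E.mean i ≤ 1 := by
  rw [mean_eq_expect, ← E.expect_const i 1]
  exact E.expect_mono i fun x a => E.rewardMean_le_one x a

end Environment

/-- The standing assumptions on the environment, the parameters and one realization of the
approximate experts. -/
structure Regular (E : Environment N X V) (P : Params) (πh : Fin N → X → V → ℝ) : Prop where
  pX_pos : 0 < P.pX
  pV_pos : 0 < P.pV
  pV_le : P.pV ≤ 1 / 2
  γ_pos : 0 < P.γ
  γ_le : P.γ ≤ 1
  M_ge : 1 ≤ P.M
  ξ_nonneg : 0 ≤ P.ξ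
  ξ_le : P.ξ ≤ P.pV / 16
  width_le : P.ξ / P.pV * (1 / (P.pV - P.ξ) + 1 / (P.pV + P.ξ)) ≤ P.γ * P.pV / 2
  ctx_ge : ∀ x, P.pX ≤ E.ctxLaw x
  policy_ge : ∀ i x a, P.pV ≤ E.policy i x a
  policy_le : ∀ i x a, E.policy i x a ≤ 1 - P.pV
  trueM_le : ∀ i j, E.trueM i j ≤ P.M
  approx : ∀ i x a, |E.policy i x a - πh i x a| ≤ P.ξ

/-- The width `\overline r - \underline r` of the confidence intervals for the ratios. -/
def Params.width (P : Params) : ℝ := P.ξ / P.pV * (1 / (P.pV - P.ξ) + 1 / (P.pV + P.ξ))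

namespace Regular

variable {E : Environment N X V} {P : Params} {πh : Fin N → X → V → ℝ}

section
variable (R : Regular E P πh)
include R

theorem ξ_lt : P.ξ < P.pV := by linarith [R.ξ_le, R.pV_pos]

theorem policy_pos (i : Fin N) (x : X) (a : V) : 0 < E.policy i x a :=
  R.pV_pos.trans_le (R.policy_ge i x a)

theorem width_nonneg : 0 ≤ P.width := by
  have := R.ξ_lt
  have h1 : 0 < P.pV - P.ξ := by linarith
  have := R.ξ_nonneg
  have := R.pV_pos
  unfold Params.width
  positivity

theorem width_le' : P.width ≤ P.γ * P.pV / 2 := R.width_le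

theorem width_le_half_pV : P.width ≤ P.pV / 2 := by
  have := mul_le_mul_of_nonneg_right R.γ_le R.pV_pos.le
  linarith [R.width_le']

theorem rUp_sub_rLow (i j : Fin N) (x : X) (a : V) :
    rUp P πh i j x a - rLow P πh i j x a = P.width := by
  have hp := R.pV_pos
  have h0 := R.ξ_nonneg
  have h1 : P.pV - P.ξ ≠ 0 := by linarith [R.ξ_lt]
  have h2 : P.pV + P.ξ ≠ 0 := by linarith
  unfold rUp rLow Params.width
  field_simp
  ring

/-- Shifting numerator up and denominator down by `ξ` changes `α / b` by `ξ (α + b) / (b (b - ξ))`.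
Under `α ≤ 1 - pV` and `b ≥ pV` this is largest at the endpoints, where `α + b = 1`. `le_rUp` is the
mirror image. -/
theorem rLow_le (i j : Fin N) (x : X) (a : V) :
    rLow P πh i j x a ≤ E.policy i x a / E.policy j x a := by
  obtain ⟨h1, h2⟩ := abs_le.1 (R.approx i x a)
  obtain ⟨h3, h4⟩ := abs_le.1 (R.approx j x a)
  have hb := R.policy_ge j x a
  have ha := R.policy_le i x a
  have ha0 := R.policy_pos i x a
  have hξ := R.ξ_lt
  have hξ0 := R.ξ_nonneg
  have hp := R.pV_pos
  unfold rLow rHat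
  set α := E.policy i x a
  set b := E.policy j x a
  have hb0 : 0 < b := by linarith
  have hbξ : 0 < b - P.ξ := by linarith
  have hpξ : 0 < P.pV - P.ξ := by linarith
  have s1 : πh i x a / πh j x a ≤ (α + P.ξ) / (b - P.ξ) := by
    apply div_le_div₀ <;> linarith
  have s2 : (α + P.ξ) / (b - P.ξ) - α / b ≤ P.ξ / (P.pV * (P.pV - P.ξ)) := by
    have e1 : (α + P.ξ) / (b - P.ξ) - α / b = P.ξ * ((α + b) / (b * (b - P.ξ))) := by
      field_simp; ring
    rw [e1, div_eq_mul_one_div P.ξ]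
    refine mul_le_mul_of_nonneg_left ?_ hξ0
    rw [div_le_div_iff₀ (by positivity) (by positivity)]
    have e2 : (α + b) * (P.pV * (P.pV - P.ξ)) ≤ (1 - P.pV + b) * (P.pV * (P.pV - P.ξ)) := by
      gcongr
    have e3 : P.pV * (P.pV - P.ξ) * b ≤ P.pV * (b - P.ξ) * b := by gcongr
    have e4 : (1 - P.pV) * (P.pV * (P.pV - P.ξ)) ≤ (1 - P.pV) * (b * (b - P.ξ)) := by
      have : 0 ≤ 1 - P.pV := by linarith
      gcongr
    nlinarith
  linarith

theorem le_rUp (i j : Fin N) (x : X) (a : V) :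
    E.policy i x a / E.policy j x a ≤ rUp P πh i j x a := by
  obtain ⟨h1, h2⟩ := abs_le.1 (R.approx i x a)
  obtain ⟨h3, h4⟩ := abs_le.1 (R.approx j x a)
  have hb := R.policy_ge j x a
  have ha := R.policy_le i x a
  have ha0 := R.policy_pos i x a
  have hap := R.policy_ge i x a
  have hξ := R.ξ_lt
  have hξ0 := R.ξ_nonneg
  have hp := R.pV_pos
  unfold rUp rHat
  set α := E.policy i x a
  set b := E.policy j x a
  have hb0 : 0 < b := by linarith
  have s1 : (α - P.ξ) / (b + P.ξ) ≤ πh i x a / πh j x a := by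
    apply div_le_div₀ <;> linarith
  have s2 : α / b - (α - P.ξ) / (b + P.ξ) ≤ P.ξ / (P.pV * (P.pV + P.ξ)) := by
    have e1 : α / b - (α - P.ξ) / (b + P.ξ) = P.ξ * ((α + b) / (b * (b + P.ξ))) := by
      field_simp; ring
    rw [e1, div_eq_mul_one_div P.ξ]
    refine mul_le_mul_of_nonneg_left ?_ hξ0
    rw [div_le_div_iff₀ (by positivity) (by positivity)]
    have e2 : (α + b) * (P.pV * (P.pV + P.ξ)) ≤ (1 - P.pV + b) * (P.pV * (P.pV + P.ξ)) := by
      gcongr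
    have e3 : P.pV * (P.pV + P.ξ) * b ≤ P.pV * (b + P.ξ) * b := by gcongr
    have e4 : (1 - P.pV) * (P.pV * (P.pV + P.ξ)) ≤ (1 - P.pV) * (b * (b + P.ξ)) := by
      have : 0 ≤ 1 - P.pV := by linarith
      gcongr
    nlinarith
  linarith

theorem ratio_sub_width_le (i j : Fin N) (x : X) (a : V) :
    E.policy i x a / E.policy j x a - P.width ≤ rLow P πh i j x a := by
  linarith [R.le_rUp i j x a, R.rUp_sub_rLow i j x a]

theorem pV_le_ratio (i j : Fin N) (x : X) (a : V) :
    P.pV ≤ E.policy i x a / E.policy j x a := by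
  have hj := R.policy_pos j x a
  rw [le_div_iff₀ hj]
  have h1 := R.policy_le j x a
  have h2 := R.policy_ge i x a
  nlinarith [R.pV_pos]

theorem ratio_le (i j : Fin N) (x : X) (a : V) :
    E.policy i x a / E.policy j x a ≤ 1 / P.pV := by
  have := R.pV_pos
  have := R.policy_ge j x a
  have := R.policy_le i x a
  gcongr
  linarith

theorem rLow_pos (i j : Fin N) (x : X) (a : V) : 0 < rLow P πh i j x a := by
  linarith [R.ratio_sub_width_le i j x a, R.pV_le_ratio i j x a, R.width_le_half_pV, R.pV_pos]

theorem rUp_pos (i j : Fin N) (x : X) (a : V) : 0 < rUp P πh i j x a :=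
  R.pV_pos.trans_le ((R.pV_le_ratio i j x a).trans (R.le_rUp i j x a))

theorem rUp_le (i j : Fin N) (x : X) (a : V) : rUp P πh i j x a ≤ 1 / P.pV + 1 := by
  linarith [R.rUp_sub_rLow i j x a, R.rLow_le i j x a, R.ratio_le i j x a, R.width_le_half_pV,
    R.pV_le]

theorem weight_le (i : Fin N) (x : X) (a : V) : πh i x a - P.ξ ≤ E.policy i x a := by
  linarith [(abs_le.1 (R.approx i x a)).1]

/-- At most `2ξ` is lost, and `2ξ ≤ pV / 8`. -/
theorem le_weight (i : Fin N) (x : X) (a : V) :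
    7 / 8 * E.policy i x a ≤ πh i x a - P.ξ := by
  linarith [(abs_le.1 (R.approx i x a)).2, R.ξ_le, R.policy_ge i x a]

/-- Nonnegativity of the chi-square divergence: `α² / b ≥ 2α - b` is `(α - b)² ≥ 0`. -/
theorem one_le_sum_ratio (i j : Fin N) (x : X) :
    1 ≤ ∑ a, E.policy i x a * (E.policy i x a / E.policy j x a) := by
  have h : ∀ a ∈ Finset.univ, 2 * E.policy i x a - E.policy j x a ≤
      E.policy i x a * (E.policy i x a / E.policy j x a) := by
    intro a _
    have hj := R.policy_pos j x a
    rw [← mul_div_assoc, le_div_iff₀ hj]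
    nlinarith [sq_nonneg (E.policy i x a - E.policy j x a)]
  refine le_trans (le_of_eq ?_) (Finset.sum_le_sum h)
  rw [Finset.sum_sub_distrib, ← Finset.mul_sum, E.policy_sum, E.policy_sum]
  norm_num

theorem inner_nonneg (i j : Fin N) (x : X) :
    0 ≤ ∑ a, E.policy i x a * f₁ (E.policy i x a / E.policy j x a) := by
  have h : ∀ a ∈ Finset.univ, 2 * (E.policy i x a * (E.policy i x a / E.policy j x a)) -
      2 * E.policy i x a ≤ E.policy i x a * f₁ (E.policy i x a / E.policy j x a) := by
    intro a _
    have h0 : 0 ≤ E.policy i x a / E.policy j x a := R.pV_pos.le.trans (R.pV_le_ratio i j x a)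
    have := mul_le_mul_of_nonneg_left (two_mul_sub_one_le_mul_exp h0) (R.policy_pos i x a).le
    unfold f₁
    linarith
  refine le_trans ?_ (Finset.sum_le_sum h)
  rw [Finset.sum_sub_distrib, ← Finset.mul_sum, ← Finset.mul_sum, E.policy_sum]
  linarith [R.one_le_sum_ratio i j x]

theorem trueD_nonneg (i j : Fin N) : 0 ≤ E.trueD i j :=
  Finset.sum_nonneg fun x _ => mul_nonneg (E.ctxLaw_nonneg x) (R.inner_nonneg i j x)

/-- `x exp(x - 1)` is increasing, so lowering weights and ratios lowers that part; only the `-1` in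
`f₁` can raise the sum, by the lost weight, at most `1 / 8`. -/
theorem estInner_le (i j : Fin N) (x : X) :
    ∑ a, (πh i x a - P.ξ) * f₁ (rLow P πh i j x a) ≤
      ∑ a, E.policy i x a * f₁ (E.policy i x a / E.policy j x a) + 1 / 8 := by
  have h : ∀ a ∈ Finset.univ, (πh i x a - P.ξ) * f₁ (rLow P πh i j x a) ≤
      E.policy i x a * f₁ (E.policy i x a / E.policy j x a) + 1 / 8 * E.policy i x a := by
    intro a _
    have h0 := (R.rLow_pos i j x a).le
    have h1 := mul_exp_mono h0 (R.rLow_le i j x a)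
    have h2 := mul_le_mul (R.weight_le i x a) h1 (by positivity) (R.policy_pos i x a).le
    have h3 := R.le_weight i x a
    unfold f₁
    linarith
  refine (Finset.sum_le_sum h).trans_eq ?_
  rw [Finset.sum_add_distrib, ← Finset.mul_sum, E.policy_sum, mul_one]

theorem le_estInner (i j : Fin N) (x : X) :
    -(9 / 16) ≤ ∑ a, (πh i x a - P.ξ) * f₁ (rLow P πh i j x a) := by
  -- A width of `1/4` turns `2r - 1` into `2r - 3/2`; with chi-square sum at least `1` the total is
  -- at least `7/8 * (2 - 3/2) - 1 = -9/16`.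
  have hw : P.width ≤ 1 / 4 := by linarith [R.width_le_half_pV, R.pV_le]
  have h : ∀ a ∈ Finset.univ,
      7 / 8 * (2 * (E.policy i x a * (E.policy i x a / E.policy j x a)) - 3 / 2 * E.policy i x a)
        - E.policy i x a ≤ (πh i x a - P.ξ) * f₁ (rLow P πh i j x a) := by
    intro a _
    have h0 := (R.rLow_pos i j x a).le
    have h1 := two_mul_sub_one_le_mul_exp h0
    have h2 := R.ratio_sub_width_le i j x a
    have hpos := R.policy_pos i x a
    have h3 : E.policy i x a * (2 * (E.policy i x a / E.policy j x a) - 3 / 2) ≤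
        E.policy i x a * (rLow P πh i j x a * Real.exp (rLow P πh i j x a - 1)) :=
      mul_le_mul_of_nonneg_left (by linarith) hpos.le
    have h4 := mul_le_mul_of_nonneg_right (R.le_weight i x a)
      (by positivity : 0 ≤ rLow P πh i j x a * Real.exp (rLow P πh i j x a - 1))
    have h5 := R.weight_le i x a
    unfold f₁
    linarith
  refine le_trans ?_ (Finset.sum_le_sum h)
  rw [Finset.sum_sub_distrib, ← Finset.mul_sum, Finset.sum_sub_distrib, ← Finset.mul_sum,
    ← Finset.mul_sum, E.policy_sum]
  linarith [R.one_le_sum_ratio i j x]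

theorem pX_mul_card_le : ∑ _x : X, P.pX ≤ 1 := by
  rw [← E.ctxLaw_sum]
  exact Finset.sum_le_sum fun x _ => R.ctx_ge x

theorem estD_le (i j : Fin N) : estD P πh i j ≤ E.trueD i j + 1 / 8 := by
  unfold estD Environment.trueD
  rw [Finset.mul_sum]
  have h : ∀ x ∈ Finset.univ, P.pX * ∑ a, (πh i x a - P.ξ) * f₁ (rLow P πh i j x a) ≤
      E.ctxLaw x * ∑ a, E.policy i x a * f₁ (E.policy i x a / E.policy j x a) +
        1 / 8 * P.pX := by
    intro x _
    have h1 := mul_le_mul_of_nonneg_left (R.estInner_le i j x) R.pX_pos.le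
    have h2 := mul_le_mul_of_nonneg_right (R.ctx_ge x) (R.inner_nonneg i j x)
    linarith
  refine (Finset.sum_le_sum h).trans ?_
  rw [Finset.sum_add_distrib, ← Finset.mul_sum]
  linarith [R.pX_mul_card_le]

theorem le_estD (i j : Fin N) : -(9 / 16) ≤ estD P πh i j := by
  unfold estD
  rw [Finset.mul_sum]
  have h : ∀ x ∈ Finset.univ, -(9 / 16) * P.pX ≤
      P.pX * ∑ a, (πh i x a - P.ξ) * f₁ (rLow P πh i j x a) := by
    intro x _
    have h1 := mul_le_mul_of_nonneg_left (R.le_estInner i j x) R.pX_pos.le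
    linarith
  refine le_trans ?_ (Finset.sum_le_sum h)
  rw [← Finset.mul_sum]
  linarith [R.pX_mul_card_le]

/-- The error `1/8` in the divergence gives the factor `9/8` inside the logarithm, so an additive
`1/8`, absorbed by `M ≥ 1`. -/
theorem estM_le (i j : Fin N) : estM P πh i j ≤ 9 / 8 * P.M := by
  have h1 := R.estD_le i j
  have h2 := R.le_estD i j
  have h0 := R.trueD_nonneg i j
  have h3 : Real.log (1 + estD P πh i j) ≤ Real.log ((1 + E.trueD i j) * (9 / 8)) :=
    Real.log_le_log (by linarith) (by linarith)
  rw [Real.log_mul (by linarith) (by norm_num)] at h3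
  have h4 := Real.log_le_sub_one_of_pos (show (0 : ℝ) < 9 / 8 by norm_num)
  have h5 := R.trueM_le i j
  unfold Environment.trueM at h5
  unfold estM
  linarith [R.M_ge]

/-- `1 + estD ≥ 7/16`, and `1 - log 2 - 1/7 > 1/8`. -/
theorem le_estM (i j : Fin N) : 1 / 8 ≤ estM P πh i j := by
  have h2 := R.le_estD i j
  have h3 : Real.log (1 / 2 * (7 / 8)) ≤ Real.log (1 + estD P πh i j) :=
    Real.log_le_log (by norm_num) (by linarith)
  rw [Real.log_mul (by norm_num) (by norm_num), one_div, Real.log_inv] at h3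
  have h4 := Real.one_sub_inv_le_log_of_pos (show (0 : ℝ) < 7 / 8 by norm_num)
  norm_num at h4
  unfold estM
  linarith [Real.log_two_lt_d9]

theorem estM_pos (i j : Fin N) : 0 < estM P πh i j := by linarith [R.le_estM i j]

theorem thirty_two_le_C : 32 ≤ P.C := by
  have h1 : P.γ * (1 - P.pV) ≤ 1 := by nlinarith [R.γ_le, R.pV_pos, R.γ_pos, R.pV_le]
  have h2 : 0 < P.γ * (1 - P.pV) := mul_pos R.γ_pos (by linarith [R.pV_le])
  unfold Params.C
  rw [le_div_iff₀ h2]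
  linarith [R.M_ge]

/-- The mean of one term of the importance sampling estimator is within the width of the truth. -/
theorem expect_rLow_mem (i j : Fin N) :
    E.mean i - P.width ≤ E.expect j (fun x a => rLow P πh i j x a * E.rewardMean x a) ∧
      E.expect j (fun x a => rLow P πh i j x a * E.rewardMean x a) ≤ E.mean i := by
  -- Importance sampling: reweighting by the true ratio moves the expectation from expert `i` to
  -- expert `j`.
  have hm : E.mean i =
      E.expect j (fun x a => E.policy i x a / E.policy j x a * E.rewardMean x a) := by
    rw [Environment.mean_eq_expect]
    unfold Environment.expect
    refine Finset.sum_congr rfl fun x _ => ?_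
    congr 1
    refine Finset.sum_congr rfl fun a _ => ?_
    have := (R.policy_pos j x a).ne'
    field_simp
  constructor
  · have h := E.expect_const j P.width
    rw [hm, ← h, ← E.expect_sub]
    refine E.expect_mono j fun x a => ?_
    have h0 := E.rewardMean_nonneg x a
    have h1 := E.rewardMean_le_one x a
    have h2 := R.ratio_sub_width_le i j x a
    have h3 := mul_le_mul_of_nonneg_right h2 h0
    have h4 := mul_le_mul_of_nonneg_left h1 R.width_nonneg
    linarith
  · rw [hm]
    exact E.expect_mono j fun x a =>
      mul_le_mul_of_nonneg_right (R.rLow_le i j x a) (E.rewardMean_nonneg x a)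

end

end Regular

end EDUCB
end

/-! ### An Azuma–Hoeffding inequality. -/

noncomputable section

namespace EDUCB

section Martingale

variable {Ω : Type z} {mΩ : MeasurableSpace Ω} {μ : Measure Ω} {ℱ : Filtration ℕ mΩ}
  {W g : ℕ → Ω → ℝ}

/-- The exponential supermartingale attached to `∑ (W - g)`. -/
def expProcess (W g : ℕ → Ω → ℝ) (θ : ℝ) (t : ℕ) (ω : Ω) : ℝ :=
  Real.exp (θ * ∑ s ∈ Icc 1 t, (W s ω - g s ω) - t * θ ^ 2)

theorem expProcess_succ (W g : ℕ → Ω → ℝ) (θ : ℝ) (t : ℕ) (ω : Ω) :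
    expProcess W g θ (t + 1) ω =
      expProcess W g θ t ω * Real.exp (-(θ * g (t + 1) ω) - θ ^ 2) *
        Real.exp (W (t + 1) ω * θ) := by
  unfold expProcess
  rw [← Real.exp_add, ← Real.exp_add, Finset.sum_Icc_succ_top (by omega)]
  push_cast
  ring_nf

theorem exp_mul_le_chord {x θ : ℝ} (hx : x ∈ Set.Icc (0 : ℝ) 1) :
    Real.exp (x * θ) ≤ 1 + x * (Real.exp θ - 1) := by
  have h := convexOn_exp.2 (Set.mem_univ 0) (Set.mem_univ θ) (sub_nonneg.2 hx.2) hx.1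
    (sub_add_cancel 1 x)
  simp only [smul_eq_mul, mul_zero, zero_add, Real.exp_zero, mul_one] at h
  linarith

/-- With the chord bound, this is the one-step supermartingale estimate: `exp θ - 1 ≤ θ + θ²` for
`|θ| ≤ 1`, then `1 + u ≤ exp u`. -/
theorem one_add_mul_exp_sub_one_le {x θ : ℝ} (hx : x ∈ Set.Icc (0 : ℝ) 1) (hθ : |θ| ≤ 1) :
    Real.exp (-(θ * x) - θ ^ 2) * (1 + x * (Real.exp θ - 1)) ≤ 1 := by
  have h1 := (abs_le.1 (Real.abs_exp_sub_one_sub_id_le hθ)).2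
  have h2 : x * (Real.exp θ - 1) ≤ x * (θ + θ ^ 2) :=
    mul_le_mul_of_nonneg_left (by linarith) hx.1
  have h3 : x * θ ^ 2 ≤ 1 * θ ^ 2 := mul_le_mul_of_nonneg_right hx.2 (sq_nonneg θ)
  have h4 := Real.add_one_le_exp (θ * x + θ ^ 2)
  calc Real.exp (-(θ * x) - θ ^ 2) * (1 + x * (Real.exp θ - 1))
      ≤ Real.exp (-(θ * x) - θ ^ 2) * Real.exp (θ * x + θ ^ 2) := by
        gcongr
        linarith
    _ = 1 := by rw [← Real.exp_add]; ring_nf; exact Real.exp_zero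

/-- Azuma–Hoeffding in exponential form: if `W (t+1) ∈ [0,1]` has conditional mean `g (t+1)` given
`ℱ t`, then `exp (θ ∑ (W - g) - t θ²)` has mean at most `1` for `|θ| ≤ 1`. -/
theorem integral_expProcess_le [IsProbabilityMeasure μ]
    (hW : ∀ t, Measurable[ℱ (t + 1)] (W (t + 1))) (hg : ∀ t, Measurable[ℱ t] (g (t + 1)))
    (hW01 : ∀ t, ∀ᵐ ω ∂μ, W (t + 1) ω ∈ Set.Icc (0 : ℝ) 1)
    (hg01 : ∀ t ω, g (t + 1) ω ∈ Set.Icc (0 : ℝ) 1)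
    (hcond : ∀ t, μ[W (t + 1)|ℱ t] =ᵐ[μ] g (t + 1)) {θ : ℝ} (hθ : |θ| ≤ 1) (t : ℕ) :
    Integrable (expProcess W g θ t) μ ∧ ∫ ω, expProcess W g θ t ω ∂μ ≤ 1 := by
  have hmeas : ∀ t, Measurable[ℱ t] (expProcess W g θ t) := by
    intro t
    induction t with
    | zero =>
      have : expProcess W g θ 0 = fun _ => 1 := by
        funext ω; simp [expProcess]
      rw [this]
      exact measurable_const
    | succ t ih =>
      have : expProcess W g θ (t + 1) = fun ω => expProcess W g θ t ω *
          Real.exp (-(θ * g (t + 1) ω) - θ ^ 2) * Real.exp (W (t + 1) ω * θ) :=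
        funext fun ω => expProcess_succ W g θ t ω
      rw [this]
      have h1 : Measurable[ℱ (t + 1)] (expProcess W g θ t) := ih.mono (ℱ.mono t.le_succ) le_rfl
      have h2 : Measurable[ℱ (t + 1)] (g (t + 1)) := (hg t).mono (ℱ.mono t.le_succ) le_rfl
      exact (h1.mul (Real.measurable_exp.comp (((h2.const_mul θ).neg).sub_const _))).mul
        (Real.measurable_exp.comp ((hW t).mul_const θ))
  have hpos : ∀ t ω, 0 < expProcess W g θ t ω := fun t ω => Real.exp_pos _
  have hbound : ∀ t, ∀ᵐ ω ∂μ, expProcess W g θ t ω ≤ Real.exp t := by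
    intro t
    have hall : ∀ᵐ ω ∂μ, ∀ s, W (s + 1) ω ∈ Set.Icc (0 : ℝ) 1 := ae_all_iff.2 hW01
    filter_upwards [hall] with ω hω
    refine Real.exp_le_exp.2 ?_
    have h1 : |∑ s ∈ Icc 1 t, (W s ω - g s ω)| ≤ ∑ s ∈ Icc 1 t, 1 := by
      refine (Finset.abs_sum_le_sum_abs _ _).trans (Finset.sum_le_sum fun s hs => ?_)
      obtain ⟨r, rfl⟩ := Nat.exists_eq_add_of_le' (Finset.mem_Icc.1 hs).1
      have ha := hω r
      have hb := hg01 r ω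
      rw [abs_le]
      constructor <;> linarith [ha.1, ha.2, hb.1, hb.2]
    have h2 : |θ * ∑ s ∈ Icc 1 t, (W s ω - g s ω)| ≤ 1 * t := by
      rw [abs_mul]
      refine mul_le_mul hθ (h1.trans_eq (by simp)) (abs_nonneg _) zero_le_one
    have h3 : 0 ≤ (t : ℝ) * θ ^ 2 := by positivity
    linarith [(abs_le.1 h2).2]
  have hint : ∀ t, Integrable (expProcess W g θ t) μ := by
    intro t
    refine Integrable.of_bound (((hmeas t).mono (ℱ.le t) le_rfl).aestronglyMeasurable)
      (Real.exp t) ?_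
    filter_upwards [hbound t] with ω hω
    rwa [Real.norm_of_nonneg (hpos t ω).le]
  refine ⟨hint t, ?_⟩
  induction t with
  | zero => simp [expProcess]
  | succ t ih =>
    refine le_trans ?_ ih
    set H : Ω → ℝ := fun ω => expProcess W g θ t ω * Real.exp (-(θ * g (t + 1) ω) - θ ^ 2) with hH
    have hHmeas : Measurable[ℱ t] H :=
      (hmeas t).mul (Real.measurable_exp.comp ((((hg t).const_mul θ).neg).sub_const _))
    have hHpos : ∀ ω, 0 ≤ H ω := fun ω => (mul_pos (hpos t ω) (Real.exp_pos _)).le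
    have hHbound : ∀ᵐ ω ∂μ, ‖H ω‖ ≤ Real.exp t * Real.exp 1 := by
      filter_upwards [hbound t] with ω hω
      rw [Real.norm_of_nonneg (hHpos ω)]
      have hb := hg01 t ω
      have h1 : |θ * g (t + 1) ω| ≤ 1 := by
        rw [abs_mul, abs_of_nonneg hb.1]
        exact mul_le_one₀ hθ hb.1 hb.2
      refine mul_le_mul hω (Real.exp_le_exp.2 ?_) (Real.exp_pos _).le (Real.exp_pos _).le
      nlinarith [(abs_le.1 h1).1, sq_nonneg θ]
    have hHint : Integrable H μ :=
      Integrable.of_bound (hHmeas.mono (ℱ.le t) le_rfl).aestronglyMeasurable _ hHbound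
    have hWmeas : Measurable (W (t + 1)) := (hW t).mono (ℱ.le _) le_rfl
    have hWint : Integrable (W (t + 1)) μ := by
      refine Integrable.of_bound hWmeas.aestronglyMeasurable 1 ?_
      filter_upwards [hW01 t] with ω hω
      rw [Real.norm_of_nonneg hω.1]; exact hω.2
    have hHW : Integrable (fun ω => H ω * W (t + 1) ω) μ :=
      hWint.bdd_mul (hHmeas.mono (ℱ.le t) le_rfl).aestronglyMeasurable hHbound
    have hgint : Integrable (g (t + 1)) μ := by
      refine Integrable.of_bound (((hg t).mono (ℱ.le _) le_rfl).aestronglyMeasurable) 1 ?_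
      filter_upwards with ω
      rw [Real.norm_of_nonneg (hg01 t ω).1]; exact (hg01 t ω).2
    have hHg : Integrable (fun ω => H ω * g (t + 1) ω) μ :=
      hgint.bdd_mul (hHmeas.mono (ℱ.le t) le_rfl).aestronglyMeasurable hHbound
    -- `H` is known at time `t`, so conditioning replaces `W (t + 1)` by its conditional mean.
    have heq : ∫ ω, H ω * W (t + 1) ω ∂μ = ∫ ω, H ω * g (t + 1) ω ∂μ := by
      have h1 := condExp_mul_of_stronglyMeasurable_left hHmeas.stronglyMeasurable hHW hWint
      have h2 := integral_condExp (μ := μ) (ℱ.le t) (f := H * W (t + 1))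
      rw [show ∫ ω, H ω * W (t + 1) ω ∂μ = ∫ ω, (H * W (t + 1)) ω ∂μ from rfl, ← h2]
      refine integral_congr_ae ?_
      filter_upwards [h1, hcond t] with ω ha hb
      rw [ha, Pi.mul_apply, hb]
    calc ∫ ω, expProcess W g θ (t + 1) ω ∂μ
        ≤ ∫ ω, (H ω + (Real.exp θ - 1) * (H ω * W (t + 1) ω)) ∂μ := by
          refine integral_mono_ae (hint _) (hHint.add (hHW.const_mul _)) ?_
          filter_upwards [hW01 t] with ω hω
          have := mul_le_mul_of_nonneg_left (exp_mul_le_chord (θ := θ) hω) (hHpos ω)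
          have e := expProcess_succ W g θ t ω
          simp only [hH] at this ⊢
          rw [e]
          linarith
      _ = ∫ ω, (H ω + (Real.exp θ - 1) * (H ω * g (t + 1) ω)) ∂μ := by
          rw [integral_add hHint (hHW.const_mul _), integral_add hHint (hHg.const_mul _),
            integral_const_mul, integral_const_mul, heq]
      _ ≤ ∫ ω, expProcess W g θ t ω ∂μ := by
          refine integral_mono (hHint.add (hHg.const_mul _)) (hint t) fun ω => ?_
          have := mul_le_mul_of_nonneg_left (one_add_mul_exp_sub_one_le (hg01 t ω) hθ)
            (hpos t ω).le
          simp only [hH]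
          linarith

/-- Azuma–Hoeffding: a deviation of size `8 √(t log t)` in a given direction has probability at most
`t⁻²`. -/
theorem measure_deviation_le [IsProbabilityMeasure μ]
    (hW : ∀ t, Measurable[ℱ (t + 1)] (W (t + 1))) (hg : ∀ t, Measurable[ℱ t] (g (t + 1)))
    (hW01 : ∀ t, ∀ᵐ ω ∂μ, W (t + 1) ω ∈ Set.Icc (0 : ℝ) 1)
    (hg01 : ∀ t ω, g (t + 1) ω ∈ Set.Icc (0 : ℝ) 1)
    (hcond : ∀ t, μ[W (t + 1)|ℱ t] =ᵐ[μ] g (t + 1)) {σ : ℝ} (hσ : |σ| = 1) {t : ℕ} (ht : 2 ≤ t) :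
    μ.real {ω | 8 * √(t * Real.log t) ≤ σ * ∑ s ∈ Icc 1 t, (W s ω - g s ω)} ≤ 1 / (t : ℝ) ^ 2 := by
  have ht0 : (0 : ℝ) < t := by exact_mod_cast (by omega : 0 < t)
  have hlog : 0 ≤ Real.log t := Real.log_natCast_nonneg t
  -- With `θ = σ r` the exponent on the deviation event is at least `8 t r² - t r² = 7 log t`, more
  -- than the `2 log t` that Markov's inequality needs; `r ≤ 1` makes `θ` admissible.
  set r := √(Real.log t / t) with hr
  have hr0 : 0 ≤ r := Real.sqrt_nonneg _
  have hr2 : t * r ^ 2 = Real.log t := by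
    rw [hr, Real.sq_sqrt (by positivity)]; field_simp
  have hθ : |σ * r| ≤ 1 := by
    rw [abs_mul, hσ, one_mul, abs_of_nonneg hr0]
    exact sqrt_log_div_le_one t
  obtain ⟨hint, hle⟩ := integral_expProcess_le (μ := μ) hW hg hW01 hg01 hcond hθ t
  have hσ2 : σ ^ 2 = 1 := by rw [← sq_abs, hσ, one_pow]
  have hsub : {ω | 8 * √(t * Real.log t) ≤ σ * ∑ s ∈ Icc 1 t, (W s ω - g s ω)} ⊆
      {ω | (t : ℝ) ^ 2 ≤ expProcess W g (σ * r) t ω} := by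
    intro ω hω
    rw [Set.mem_ofPred_eq, sqrt_mul_log_eq, ← hr] at hω
    have h1 := mul_le_mul_of_nonneg_left hω hr0
    rw [Set.mem_ofPred_eq, expProcess, ← Real.log_le_iff_le_exp (by positivity), Real.log_pow,
      mul_pow, hσ2, one_mul, hr2]
    push_cast
    have h2 : r * (8 * (t * r)) = 8 * (t * r ^ 2) := by ring
    rw [h2, hr2] at h1
    linarith
  have h := mul_meas_ge_le_integral_of_nonneg (μ := μ)
    (f := expProcess W g (σ * r) t) (Filter.Eventually.of_forall fun ω => (Real.exp_pos _).le)
    hint ((t : ℝ) ^ 2)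
  have h' : μ.real {ω | 8 * √(t * Real.log t) ≤ σ * ∑ s ∈ Icc 1 t, (W s ω - g s ω)} ≤
      μ.real {ω | (t : ℝ) ^ 2 ≤ expProcess W g (σ * r) t ω} := measureReal_mono hsub
  rw [le_div_iff₀ (by positivity)]
  have := mul_le_mul_of_nonneg_left h' (sq_nonneg (t : ℝ))
  linarith

end Martingale

/-! ### The conditional law of one round of a run. -/

section Run

variable {N : ℕ} {X : Type u} {V : Type v} [Fintype X] [Fintype V]
  {E : Environment N X V} {P : Params} {πh : Fin N → X → V → ℝ}
  {Ω : Type z} {mΩ : MeasurableSpace Ω} {μ : Measure Ω} {ℱ : Filtration ℕ mΩ}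
  {k : ℕ → Ω → Fin N} {cx : ℕ → Ω → X} {av : ℕ → Ω → V} {y : ℕ → Ω → ℝ}

/-- Measurability of experts, contexts and actions is given through level sets, so the finite type
receives the discrete σ-algebra. -/
theorem measurable_comp_of_finite {α : Type*} [Finite α] {m : MeasurableSpace Ω} {f : Ω → α}
    (hf : ∀ a, MeasurableSet[m] {ω | f ω = a}) (F : α → ℝ) : Measurable[m] fun ω => F (f ω) := by
  let _ : MeasurableSpace α := ⊤
  exact (measurable_from_top (f := F)).comp (measurable_to_countable' hf)

namespace IsRun

variable (H : IsRun E P πh μ ℱ k cx av y)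
include H

theorem measurableSet_event (t : ℕ) (x : X) (a : V) :
    MeasurableSet[ℱ (t + 1)] {ω | cx (t + 1) ω = x ∧ av (t + 1) ω = a} :=
  (H.context_adapted t x).inter (H.action_adapted t a)

theorem measurable_reward (t : ℕ) : Measurable (y (t + 1)) :=
  (H.reward_adapted t).mono (ℱ.le _) le_rfl

theorem measurable_weight (t : ℕ) (c : Fin N → X → V → ℝ) :
    Measurable[ℱ (t + 1)] fun ω => c (k (t + 1) ω) (cx (t + 1) ω) (av (t + 1) ω) := by
  refine measurable_comp_of_finite (f := fun ω => (k (t + 1) ω, cx (t + 1) ω, av (t + 1) ω)) ?_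
    (fun q => c q.1 q.2.1 q.2.2)
  rintro ⟨j, x, a⟩
  have : {ω | (k (t + 1) ω, cx (t + 1) ω, av (t + 1) ω) = (j, x, a)} =
      {ω | k (t + 1) ω = j} ∩ {ω | cx (t + 1) ω = x ∧ av (t + 1) ω = a} := by
    ext ω; simp
  rw [this]
  exact (ℱ.mono t.le_succ _ (H.expert_predictable t j)).inter (H.measurableSet_event t x a)

theorem measurable_expert (t : ℕ) (c : Fin N → ℝ) :
    Measurable[ℱ t] fun ω => c (k (t + 1) ω) :=
  measurable_comp_of_finite (H.expert_predictable t) c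

variable [IsProbabilityMeasure μ]

/-- On an event of the past, the joint law of context, action and reward. -/
theorem measure_event (t : ℕ) (x : X) (a : V) {A : Set Ω} (hA : MeasurableSet[ℱ t] A)
    {B : Set ℝ} (hB : MeasurableSet B) :
    μ.real (A ∩ {ω | cx (t + 1) ω = x ∧ av (t + 1) ω = a ∧ y (t + 1) ω ∈ B}) =
      (∫ ω in A, E.ctxLaw x * E.policy (k (t + 1) ω) x a ∂μ) * (E.rewardLaw x a).real B := by
  have hS : MeasurableSet {ω | cx (t + 1) ω = x ∧ av (t + 1) ω = a ∧ y (t + 1) ω ∈ B} := by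
    have h1 := (H.measurableSet_event t x a).inter (H.reward_adapted t hB)
    have h2 := ℱ.le (t + 1) _ h1
    convert h2 using 1
    ext ω; simp [and_assoc]
  have h1 := setIntegral_condExp (μ := μ) (ℱ.le t)
    ((integrable_const (1 : ℝ)).indicator hS) hA
  rw [setIntegral_congr_ae (g := fun ω => E.ctxLaw x * E.policy (k (t + 1) ω) x a *
      (E.rewardLaw x a).real B) (ℱ.le t _ hA)
      ((H.law t x a B hB).mono fun ω hω _ => hω), integral_mul_const] at h1
  rw [h1, integral_indicator hS]
  simp [Measure.restrict_apply, hS, Set.inter_comm, measureReal_def]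

theorem reward_mem (t : ℕ) : ∀ᵐ ω ∂μ, y (t + 1) ω ∈ Set.Icc (0 : ℝ) 1 := by
  have h : ∀ x a, ∀ᵐ ω ∂μ,
      ¬ (cx (t + 1) ω = x ∧ av (t + 1) ω = a ∧ y (t + 1) ω ∈ (Set.Icc (0 : ℝ) 1)ᶜ) := by
    intro x a
    have h1 := H.measure_event t x a MeasurableSet.univ (measurableSet_Icc (a := (0 : ℝ))
      (b := 1)).compl
    have h0 : (E.rewardLaw x a).real (Set.Icc (0 : ℝ) 1)ᶜ = 0 := by
      have h2 : E.rewardLaw x a (Set.Icc (0 : ℝ) 1)ᶜ = 0 := E.rewardLaw_ae_mem x a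
      rw [measureReal_def, h2, ENNReal.toReal_zero]
    rw [h0, mul_zero, Set.univ_inter, measureReal_eq_zero_iff] at h1
    rw [ae_iff]
    simpa using h1
  have h' : ∀ᵐ ω ∂μ, ∀ x a,
      ¬ (cx (t + 1) ω = x ∧ av (t + 1) ω = a ∧ y (t + 1) ω ∈ (Set.Icc (0 : ℝ) 1)ᶜ) :=
    ae_all_iff.2 fun x => ae_all_iff.2 fun a => h x a
  filter_upwards [h'] with ω hω
  by_contra hn
  exact hω _ _ ⟨rfl, rfl, hn⟩

theorem integrable_reward (t : ℕ) : Integrable (y (t + 1)) μ := by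
  refine Integrable.of_bound (H.measurable_reward t).aestronglyMeasurable 1 ?_
  filter_upwards [H.reward_mem t] with ω hω
  rw [Real.norm_of_nonneg hω.1]; exact hω.2

/-- Conditional mean of the reward on the event that a given context and action occur. -/
theorem condExp_reward_indicator (t : ℕ) (x : X) (a : V) :
    μ[({ω | cx (t + 1) ω = x ∧ av (t + 1) ω = a}).indicator (y (t + 1))|ℱ t] =ᵐ[μ]
      fun ω => E.ctxLaw x * E.policy (k (t + 1) ω) x a * E.rewardMean x a := by
  have hS : MeasurableSet {ω | cx (t + 1) ω = x ∧ av (t + 1) ω = a} :=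
    ℱ.le _ _ (H.measurableSet_event t x a)
  have hg : Measurable[ℱ t] fun ω => E.ctxLaw x * E.policy (k (t + 1) ω) x a * E.rewardMean x a :=
    H.measurable_expert t fun j => E.ctxLaw x * E.policy j x a * E.rewardMean x a
  have hgint : ∀ c : Fin N → ℝ, Integrable (fun ω => c (k (t + 1) ω)) μ := by
    intro c
    refine Integrable.of_bound
      ((H.measurable_expert t c).mono (ℱ.le t) le_rfl).aestronglyMeasurable (∑ j, |c j|) ?_
    filter_upwards with ω
    exact Finset.single_le_sum (f := fun j => |c j|) (fun j _ => abs_nonneg _)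
      (Finset.mem_univ (k (t + 1) ω))
  refine (ae_eq_condExp_of_forall_setIntegral_eq (ℱ.le t)
    ((H.integrable_reward t).indicator hS)
    (fun A _ _ => (hgint fun j =>
      E.ctxLaw x * E.policy j x a * E.rewardMean x a).integrableOn) ?_
    hg.stronglyMeasurable.aestronglyMeasurable).symm
  intro A hA _
  have hA' := ℱ.le t _ hA
  have hym := H.measurable_reward t
  have := E.rewardLaw_prob x a
  set c := ∫ ω in A, E.ctxLaw x * E.policy (k (t + 1) ω) x a ∂μ with hc
  have hc0 : 0 ≤ c := integral_nonneg fun ω =>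
    mul_nonneg (E.ctxLaw_nonneg x) (E.policy_nonneg _ x a)
  set S := {ω | cx (t + 1) ω = x ∧ av (t + 1) ω = a} with hSdef
  -- On the past event `A` and the event `S`, the reward is distributed as a multiple of `rewardLaw
  -- x a`; this passes from probabilities of sets `B` to the mean.
  have hmap : (μ.restrict (A ∩ S)).map (y (t + 1)) = ENNReal.ofReal c • E.rewardLaw x a := by
    refine Measure.ext fun B hB => ?_
    have h1 := H.measure_event t x a hA hB
    rw [← hc] at h1
    rw [Measure.map_apply hym hB, Measure.restrict_apply (hym hB), Measure.smul_apply,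
      smul_eq_mul, ← ofReal_measureReal (μ := E.rewardLaw x a), ← ENNReal.ofReal_mul hc0, ← h1,
      ofReal_measureReal]
    congr 1
    ext ω
    simp only [hSdef, Set.mem_inter_iff, Set.mem_preimage, Set.mem_ofPred_eq]
    tauto
  have h2 : ∫ ω in A ∩ S, y (t + 1) ω ∂μ = c * E.rewardMean x a := by
    rw [← integral_map (f := fun z => z) hym.aemeasurable measurable_id.aestronglyMeasurable, hmap,
      integral_smul_measure, ENNReal.toReal_ofReal hc0, smul_eq_mul]
    rfl
  rw [setIntegral_indicator hS, h2, integral_mul_const]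

/-- Conditional mean of a reward weighted by a function of the expert, context and action. -/
theorem condExp_weighted_reward (t : ℕ) (c : Fin N → X → V → ℝ) :
    μ[fun ω => c (k (t + 1) ω) (cx (t + 1) ω) (av (t + 1) ω) * y (t + 1) ω|ℱ t] =ᵐ[μ]
      fun ω => E.expect (k (t + 1) ω) fun x a => c (k (t + 1) ω) x a * E.rewardMean x a := by
  classical
  set S : X × V → Set Ω := fun q => {ω | cx (t + 1) ω = q.1 ∧ av (t + 1) ω = q.2} with hSdef
  have hS : ∀ q, MeasurableSet (S q) := fun q => ℱ.le _ _ (H.measurableSet_event t q.1 q.2)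
  have hcm : ∀ q : X × V, Measurable[ℱ t] fun ω => c (k (t + 1) ω) q.1 q.2 := fun q =>
    H.measurable_expert t fun j => c j q.1 q.2
  have hyint : ∀ q, Integrable ((S q).indicator (y (t + 1))) μ := fun q =>
    (H.integrable_reward t).indicator (hS q)
  have hint : ∀ q : X × V, Integrable
      ((fun ω => c (k (t + 1) ω) q.1 q.2) * (S q).indicator (y (t + 1))) μ := by
    intro q
    refine (hyint q).bdd_mul (c := ∑ j, |c j q.1 q.2|)
      ((hcm q).mono (ℱ.le t) le_rfl).aestronglyMeasurable ?_
    filter_upwards with ω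
    exact Finset.single_le_sum (f := fun j => |c j q.1 q.2|) (fun j _ => abs_nonneg _)
      (Finset.mem_univ (k (t + 1) ω))
  -- Splitting by context and action leaves coefficients depending only on the expert, which is
  -- already known at time `t`.
  have hdecomp : (fun ω => c (k (t + 1) ω) (cx (t + 1) ω) (av (t + 1) ω) * y (t + 1) ω) =
      ∑ q : X × V, (fun ω => c (k (t + 1) ω) q.1 q.2) * (S q).indicator (y (t + 1)) := by
    funext ω
    rw [Finset.sum_apply, Finset.sum_eq_single (cx (t + 1) ω, av (t + 1) ω)]
    · simp [hSdef]
    · intro q _ hq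
      have : ω ∉ S q := fun h => hq (Prod.ext h.1.symm h.2.symm)
      simp [this]
    · simp
  rw [hdecomp]
  refine (condExp_finsetSum (fun q _ => hint q) (ℱ t)).trans ?_
  have hq : ∀ᵐ ω ∂μ, ∀ q : X × V,
      (μ[(fun ω => c (k (t + 1) ω) q.1 q.2) * (S q).indicator (y (t + 1))|ℱ t]) ω =
        c (k (t + 1) ω) q.1 q.2 *
          (E.ctxLaw q.1 * E.policy (k (t + 1) ω) q.1 q.2 * E.rewardMean q.1 q.2) := by
    refine ae_all_iff.2 fun q => ?_
    filter_upwards [condExp_mul_of_stronglyMeasurable_left (hcm q).stronglyMeasurable (hint q)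
      (hyint q), H.condExp_reward_indicator t q.1 q.2] with ω h1 h2
    rw [h1, Pi.mul_apply, h2]
  filter_upwards [hq] with ω hω
  rw [Finset.sum_apply, Finset.sum_congr rfl fun q _ => hω q, Fintype.sum_prod_type]
  unfold Environment.expect
  refine Finset.sum_congr rfl fun x _ => ?_
  rw [Finset.mul_sum]
  refine Finset.sum_congr rfl fun a _ => ?_
  ring

end IsRun

end Run

end EDUCB
end

/-! ### Clipping levels and the times `T_clip`, `τ_k`. -/

noncomputable section

namespace EDUCB

variable {N : ℕ} {X : Type u} {V : Type v} [Fintype X] [Fintype V]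
  {E : Environment N X V} {P : Params} {πh : Fin N → X → V → ℝ}

theorem estY_eq_of_mem_clipTimes {t : ℕ} (ht : t ∈ clipTimes P πh) (k : ℕ → Fin N) (cx : ℕ → X) (av : ℕ → V)
    (y : ℕ → ℝ) (i : Fin N) : estY P πh k cx av y i t = (Z P πh k i t)⁻¹ *
      ∑ s ∈ Icc 1 t, y s / estM P πh i (k s) * rLow P πh i (k s) (cx s) (av s) := by
  unfold estY
  simp only [ht.2 k i, if_true, mul_one]

namespace Regular

variable (R : Regular E P πh)
include R

theorem C_pos : 0 < P.C := by linarith [R.thirty_two_le_C]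

theorem Z_pos (k : ℕ → Fin N) (i : Fin N) {t : ℕ} (ht : 2 ≤ t) : 0 < Z P πh k i t :=
  Finset.sum_pos (fun s _ => inv_pos.2 (R.estM_pos i (k s))) ⟨1, Finset.mem_Icc.2 ⟨le_rfl, by omega⟩⟩

theorem clip_arg_pos (k : ℕ → Fin N) (i : Fin N) {t : ℕ} (ht : 2 ≤ t) :
    0 < √(t * Real.log t) / Z P πh k i t := by
  have h := sqrt_log_div_pos ht
  have ht0 : (0 : ℝ) < t := by exact_mod_cast (by omega : 0 < t)
  rw [sqrt_mul_log_eq]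
  exact div_pos (mul_pos ht0 h) (R.Z_pos k i ht)

theorem eps_pos (k : ℕ → Fin N) (i : Fin N) {t : ℕ} (ht : 2 ≤ t) : 0 < eps P πh k i t :=
  mul_pos R.C_pos (w_spec (R.clip_arg_pos k i ht)).1

theorem passes_iff (k : ℕ → Fin N) (i : Fin N) {t : ℕ} (ht : 2 ≤ t) (j : Fin N) (x : X) (a : V) :
    Passes P πh k i t j x a ↔
      rUp P πh i j x a ≤ 2 * Real.log (2 / eps P πh k i t) * estM P πh i j :=
  or_iff_right (R.eps_pos k i ht).ne'

/-- `Z` is at least `t / B` whatever was played, so all random confidence levels are controlled by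
the deterministic `√(log t / t)`. -/
theorem clip_arg_le (k : ℕ → Fin N) (i : Fin N) {t : ℕ} (ht : 2 ≤ t) {B : ℝ}
    (hB : ∀ j, estM P πh i j ≤ B) :
    √(t * Real.log t) / Z P πh k i t ≤ B * √(Real.log t / t) := by
  have ht0 : (0 : ℝ) < t := by exact_mod_cast (by omega : 0 < t)
  have hB0 : 0 < B := (R.estM_pos i (k 0)).trans_le (hB _)
  have hZ : t * B⁻¹ ≤ Z P πh k i t := by
    have : ∑ _s ∈ Icc 1 t, B⁻¹ = t * B⁻¹ := by simp
    rw [← this]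
    exact Finset.sum_le_sum fun s _ => inv_anti₀ (R.estM_pos i (k s)) (hB _)
  rw [sqrt_mul_log_eq, div_le_iff₀ (R.Z_pos k i ht)]
  calc t * √(Real.log t / t) = B * √(Real.log t / t) * (t * B⁻¹) := by field_simp
    _ ≤ B * √(Real.log t / t) * Z P πh k i t := by gcongr

theorem eps_le (k : ℕ → Fin N) (i : Fin N) {t : ℕ} (ht : 2 ≤ t) {y : ℝ} (hy : 0 < y)
    (h : 9 / 8 * P.M * √(Real.log t / t) ≤ y / Real.log (2 / y)) :
    eps P πh k i t ≤ P.C * y :=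
  mul_le_mul_of_nonneg_left (w_le (R.clip_arg_pos k i ht) hy
    ((R.clip_arg_le k i ht fun j => R.estM_le i j).trans h)) R.C_pos.le

/-- For `u = ε / C` the equation of `w` reads `u Z = √(t log t) log(2/u)`. Multiply by `C ≥ 32` and
use `u ≤ ε`. -/
theorem log_two_div_eps_le (k : ℕ → Fin N) (i : Fin N) {t : ℕ} (ht : 2 ≤ t) :
    16 * (√(t * Real.log t) * (2 * Real.log (2 / eps P πh k i t))) ≤
      eps P πh k i t * Z P πh k i t := by
  obtain ⟨h1, h2, h3⟩ := w_spec (R.clip_arg_pos k i ht)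
  have hZ := R.Z_pos k i ht
  set u := w (√(t * Real.log t) / Z P πh k i t) with hu
  have he : eps P πh k i t = P.C * u := rfl
  have hlog := log_two_div_pos h1 h2
  have hC := R.thirty_two_le_C
  have hle : Real.log (2 / eps P πh k i t) ≤ Real.log (2 / u) := by
    refine Real.log_le_log (div_pos two_pos (R.eps_pos k i ht)) ?_
    rw [he]
    refine div_le_div_of_nonneg_left two_pos.le h1 ?_
    nlinarith
  have huZ : u * Z P πh k i t = √(t * Real.log t) * Real.log (2 / u) := by
    field_simp at h3
    linarith
  calc 16 * (√(t * Real.log t) * (2 * Real.log (2 / eps P πh k i t)))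
      = 32 * (√(t * Real.log t) * Real.log (2 / eps P πh k i t)) := by ring
    _ ≤ 32 * (√(t * Real.log t) * Real.log (2 / u)) := by gcongr
    _ ≤ P.C * (√(t * Real.log t) * Real.log (2 / u)) := by gcongr
    _ = eps P πh k i t * Z P πh k i t := by rw [← huZ, he]; ring

/-- The worst history always plays the expert `jm` of largest `estM`, which minimizes `Z`. Comparing
any history at `t` with this one at `s` shows that `ε` has not grown. -/
theorem mem_clipTimes_of_le {s t : ℕ} (hs : s ∈ clipTimes P πh) (hst : s ≤ t) (ht : 4 ≤ t) :
    t ∈ clipTimes P πh := by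
  refine ⟨by omega, fun k i j x a => ?_⟩
  obtain ⟨hs2, hpass⟩ := hs
  have : Nonempty (Fin N) := ⟨i⟩
  obtain ⟨jm, hjm⟩ := Finite.exists_max (estM P πh i)
  have h1 := (R.passes_iff _ i hs2 j x a).1 (hpass (fun _ => jm) i j x a)
  rw [R.passes_iff k i (by omega) j x a]
  refine h1.trans ?_
  have hs0 : (0 : ℝ) < s := by exact_mod_cast (by omega : 0 < s)
  have hm := R.estM_pos i jm
  have harg : √(s * Real.log s) / Z P πh (fun _ => jm) i s =
      estM P πh i jm * √(Real.log s / s) := by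
    rw [sqrt_mul_log_eq]
    have : Z P πh (fun _ => jm) i s = s * (estM P πh i jm)⁻¹ := by simp [Z]
    rw [this]
    field_simp
  have hle : √(t * Real.log t) / Z P πh k i t ≤ √(s * Real.log s) / Z P πh (fun _ => jm) i s := by
    rw [harg]
    refine (R.clip_arg_le k i (by omega) hjm).trans ?_
    exact mul_le_mul_of_nonneg_left (Real.sqrt_le_sqrt (log_div_nat_le hs2 hst ht)) hm.le
  have heps : eps P πh k i t ≤ eps P πh (fun _ => jm) i s :=
    mul_le_mul_of_nonneg_left (w_mono (R.clip_arg_pos k i (by omega)) hle) R.C_pos.le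
  have hlog : Real.log (2 / eps P πh (fun _ => jm) i s) ≤ Real.log (2 / eps P πh k i t) :=
    Real.log_le_log (div_pos two_pos (R.eps_pos _ i hs2))
      (div_le_div_of_nonneg_left two_pos.le (R.eps_pos k i (by omega)) heps)
  exact mul_le_mul_of_nonneg_right (by linarith) (R.estM_pos i j).le

/-- A time from which the clippers are passed, expressed by the parameters only. -/
theorem mem_clipTimes {t : ℕ} (ht : 2 ≤ t) {y : ℝ}
    (hy : y = 2 * Real.exp (-(4 * (1 / P.pV + 1))) / P.C)
    (h : 9 / 8 * P.M * √(Real.log t / t) ≤ y / Real.log (2 / y)) : t ∈ clipTimes P πh := by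
  refine ⟨ht, fun k i j x a => ?_⟩
  have hC := R.C_pos
  have hp := R.pV_pos
  have hy0 : 0 < y := by rw [hy]; positivity
  have heps := R.eps_le k i ht hy0 h
  have hCy : P.C * y = 2 * Real.exp (-(4 * (1 / P.pV + 1))) := by rw [hy]; field_simp
  rw [R.passes_iff k i ht]
  -- `y` is chosen for this bound: with `estM ≥ 1/8` the clipper level is at least `1/pV + 1`, which
  -- dominates every `rUp`.
  have hlog : 4 * (1 / P.pV + 1) ≤ Real.log (2 / eps P πh k i t) := by
    rw [Real.le_log_iff_exp_le (div_pos two_pos (R.eps_pos k i ht)),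
      le_div_iff₀ (R.eps_pos k i ht)]
    calc Real.exp (4 * (1 / P.pV + 1)) * eps P πh k i t
        ≤ Real.exp (4 * (1 / P.pV + 1)) * (2 * Real.exp (-(4 * (1 / P.pV + 1)))) := by
          rw [← hCy]; gcongr
      _ = 2 := by rw [mul_left_comm, ← Real.exp_add]; simp
  have hq : 0 < 1 / P.pV + 1 := by positivity
  calc rUp P πh i j x a ≤ 2 * (4 * (1 / P.pV + 1)) * (1 / 8) := by
        linarith [R.rUp_le i j x a]
    _ ≤ 2 * Real.log (2 / eps P πh k i t) * estM P πh i j := by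
        refine mul_le_mul (by linarith) (R.le_estM i j) (by norm_num) ?_
        linarith

/-- `C ≥ 32` and `γ ≤ 1` force `√(log t / t) ≤ 1/32`, impossible for `t = 2, 3`. So `T_1 ≥ 4`, and
past it `log t / t` stays below its values at the earlier times. -/
theorem four_le_of_mem_tau1Times {t : ℕ} (h : t ∈ tau1Times P) : 4 ≤ t := by
  obtain ⟨ht, hle⟩ := h
  by_contra! hlt
  have hx := sqrt_log_div_pos ht
  have hw : w √(Real.log t / t) ≤ 1 / 32 := by
    have h0 := (w_spec hx).1
    nlinarith [R.thirty_two_le_C, R.γ_le]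
  have h1 := le_of_w_le hx (by norm_num) hw
  have h2 : (1 : ℝ) ≤ Real.log (2 / (1 / 32)) := by
    rw [Real.le_log_iff_exp_le (by norm_num)]
    linarith [Real.exp_one_lt_d9]
  have h3 : (1 / 32 : ℝ) / Real.log (2 / (1 / 32)) ≤ 1 / 32 :=
    div_le_self (by norm_num) h2
  have h4 := (Real.sqrt_le_left (by norm_num)).1 (h1.trans h3)
  have ht2 : (2 : ℝ) ≤ t := by exact_mod_cast ht
  have ht4 : (t : ℝ) < 4 := by exact_mod_cast hlt
  have h5 : Real.log 2 ≤ Real.log t := Real.log_le_log two_pos ht2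
  rw [div_le_iff₀ (by linarith)] at h4
  linarith [Real.log_two_gt_d9]

theorem mem_tau1Times {t : ℕ} (ht : 2 ≤ t)
    (h : √(Real.log t / t) ≤ P.γ / P.C / Real.log (2 / (P.γ / P.C))) : t ∈ tau1Times P := by
  refine ⟨ht, ?_⟩
  have hC := R.C_pos
  have h1 := w_le (sqrt_log_div_pos ht) (div_pos R.γ_pos hC) h
  calc P.C * w √(Real.log t / t) ≤ P.C * (P.γ / P.C) := by gcongr
    _ = P.γ := by field_simp

theorem one_lt_six_C_div {D : ℝ} (hD : 0 < D) (hD1 : D ≤ 1) : 1 < 6 * P.C / D := by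
  rw [one_lt_div hD]
  linarith [R.thirty_two_le_C]

/-- Being in `tauTimes`, expressed by `√(log t / t)`. -/
theorem mem_tauTimes_iff {t : ℕ} {Δ : ℝ} (hD : 0 < Δ - P.γ * P.pV) (hD1 : Δ - P.γ * P.pV ≤ 1) :
    t ∈ tauTimes P Δ ↔ 2 ≤ t ∧ √(Real.log t / t) ≤
      (Δ - P.γ * P.pV) / (3 * P.C * P.M * Real.log (6 * P.C / (Δ - P.γ * P.pV))) := by
  refine and_congr_right fun ht => ?_
  set D := Δ - P.γ * P.pV
  have hC := R.C_pos
  have hM : 0 < P.M := by linarith [R.M_ge]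
  have hℓ := Real.log_pos (R.one_lt_six_C_div hD hD1)
  set ℓ := Real.log (6 * P.C / D)
  have ht1 : (1 : ℝ) < t := by exact_mod_cast ht
  have hlog := Real.log_pos ht1
  rw [Real.sqrt_le_left (by positivity), div_pow, div_le_div_iff₀ (by positivity) hlog,
    div_le_div_iff₀ (by linarith) (by positivity)]
  constructor <;> intro h <;> nlinarith

theorem mem_tauTimes_of_le {s t : ℕ} {Δ : ℝ} (hD : 0 < Δ - P.γ * P.pV)
    (hD1 : Δ - P.γ * P.pV ≤ 1) (hs : s ∈ tauTimes P Δ) (hst : s ≤ t) (ht : 4 ≤ t) :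
    t ∈ tauTimes P Δ := by
  rw [R.mem_tauTimes_iff hD hD1] at hs ⊢
  exact ⟨by omega, (Real.sqrt_le_sqrt (log_div_nat_le hs.1 hst ht)).trans hs.2⟩

/-- The threshold `D / log(6C/D)` increases with `D`. This makes the times `T_k` antitone in the
gap. -/
theorem tauTimes_subset {Δ Δ' : ℝ} (hD : 0 < Δ - P.γ * P.pV) (hΔ : Δ ≤ Δ')
    (hD1 : Δ' - P.γ * P.pV ≤ 1) : tauTimes P Δ ⊆ tauTimes P Δ' := by
  intro t ht
  rw [R.mem_tauTimes_iff hD (by linarith)] at ht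
  rw [R.mem_tauTimes_iff (by linarith) hD1]
  refine ⟨ht.1, ht.2.trans ?_⟩
  have hC := R.C_pos
  have hM : 0 < P.M := by linarith [R.M_ge]
  have hℓ := Real.log_pos (R.one_lt_six_C_div (D := Δ' - P.γ * P.pV) (by linarith) hD1)
  have hle : Real.log (6 * P.C / (Δ' - P.γ * P.pV)) ≤ Real.log (6 * P.C / (Δ - P.γ * P.pV)) := by
    refine Real.log_le_log (div_pos (by linarith) (by linarith)) ?_
    gcongr
  gcongr
  linarith

theorem eps_le_of_mem_tauTimes {t : ℕ} {Δ : ℝ} (hD : 0 < Δ - P.γ * P.pV)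
    (hD1 : Δ - P.γ * P.pV ≤ 1) (h : t ∈ tauTimes P Δ) (k : ℕ → Fin N) (i : Fin N) :
    eps P πh k i t ≤ 3 / 8 * (Δ - P.γ * P.pV) := by
  rw [R.mem_tauTimes_iff hD hD1] at h
  have hC := R.thirty_two_le_C
  have hC0 := R.C_pos
  have hM : 0 < P.M := by linarith [R.M_ge]
  have hℓ := Real.log_pos (R.one_lt_six_C_div hD hD1)
  set D := Δ - P.γ * P.pV
  set ℓ := Real.log (6 * P.C / D)
  -- `3/8` is `9/8` from `estM_le` times `1/3` from `τ_k`; the logarithm fits because `2 / y = 16C /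
  -- (3D) ≤ 6C / D`.
  have hy : 0 < 3 * D / (8 * P.C) := by positivity
  have hy2 : 3 * D / (8 * P.C) < 2 := by
    rw [div_lt_iff₀ (by positivity)]; linarith
  refine (R.eps_le k i h.1 hy ?_).trans_eq (by field_simp)
  have hlog := log_two_div_pos hy hy2
  have hle : Real.log (2 / (3 * D / (8 * P.C))) ≤ ℓ := by
    refine Real.log_le_log (by positivity) ?_
    rw [div_div_eq_mul_div, div_le_div_iff₀ (by positivity) hD]
    nlinarith [mul_pos hC0 hD]
  calc 9 / 8 * P.M * √(Real.log t / t) ≤ 9 / 8 * P.M * (D / (3 * P.C * P.M * ℓ)) := by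
        gcongr
        exact h.2
    _ = 3 * D / (8 * P.C) / ℓ := by field_simp; norm_num
    _ ≤ _ := by gcongr

theorem err_eq_width {t : ℕ} (ht : t ∈ clipTimes P πh) (k : ℕ → Fin N) (i : Fin N) [Nonempty X]
    [Nonempty V] : err P πh k i t = P.width := by
  have : Nonempty (Fin N) := ⟨i⟩
  unfold err
  simp only [ht.2 k i, if_true, mul_one, R.rUp_sub_rLow]
  exact ciSup_const

end Regular

/-- The largest normalized ratio of expert `i`. -/
def maxRatio (P : Params) (πh : Fin N → X → V → ℝ) (i : Fin N) : ℝ :=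
  ⨆ q : Fin N × X × V, rUp P πh i q.1 q.2.1 q.2.2 / estM P πh i q.1

theorem rUp_div_le_maxRatio (i j : Fin N) (x : X) (a : V) :
    rUp P πh i j x a / estM P πh i j ≤ maxRatio P πh i :=
  le_ciSup (f := fun q : Fin N × X × V => rUp P πh i q.1 q.2.1 q.2.2 / estM P πh i q.1)
    (Set.finite_range _).bddAbove (j, x, a)

/-- Conditional mean of one term `Y_s \underline r_{ij}` of the estimator when expert `j` plays. -/
def termMean (E : Environment N X V) (P : Params) (πh : Fin N → X → V → ℝ) (i j : Fin N) : ℝ :=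
  E.expect j fun x a => rLow P πh i j x a * E.rewardMean x a

namespace Regular

variable (R : Regular E P πh)
include R

theorem maxRatio_pos (i : Fin N) [hX : Nonempty X] [hV : Nonempty V] : 0 < maxRatio P πh i :=
  (div_pos (R.rUp_pos i i hX.some hV.some) (R.estM_pos i i)).trans_le (rUp_div_le_maxRatio (P := P) (πh := πh) i i _ _)

theorem maxRatio_le {t : ℕ} (ht : t ∈ clipTimes P πh) (k : ℕ → Fin N) (i : Fin N) [Nonempty X]
    [Nonempty V] : maxRatio P πh i ≤ 2 * Real.log (2 / eps P πh k i t) := by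
  have : Nonempty (Fin N) := ⟨i⟩
  refine ciSup_le fun q => ?_
  rw [div_le_iff₀ (R.estM_pos _ _)]
  exact (R.passes_iff k i ht.1 _ _ _).1 (ht.2 k i q.1 q.2.1 q.2.2)

/-- At a time when all clippers are passed, `ε_i(t) Z_i(t) / 2` dominates the deviations of the
estimator. -/
theorem maxRatio_mul_le {t : ℕ} (ht : t ∈ clipTimes P πh) (k : ℕ → Fin N) (i : Fin N) [Nonempty X]
    [Nonempty V] : maxRatio P πh i * (8 * √(t * Real.log t)) ≤
      eps P πh k i t / 2 * Z P πh k i t := by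
  have h1 := R.log_two_div_eps_le k i ht.1
  have h2 := mul_le_mul_of_nonneg_right (R.maxRatio_le ht k i)
    (Real.sqrt_nonneg (t * Real.log t))
  linarith

end Regular

/-! ### Concentration of the estimators and of the indices. -/

variable {Ω : Type z} {mΩ : MeasurableSpace Ω} {μ : Measure Ω} {ℱ : Filtration ℕ mΩ}
  {k : ℕ → Ω → Fin N} {cx : ℕ → Ω → X} {av : ℕ → Ω → V} {y : ℕ → Ω → ℝ}

/-- The centred sum in the numerator of the unclipped estimator of expert `i`. -/
def centredSum (E : Environment N X V) (P : Params) (πh : Fin N → X → V → ℝ)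
    (k : ℕ → Fin N) (cx : ℕ → X) (av : ℕ → V) (y : ℕ → ℝ) (i : Fin N) (t : ℕ) : ℝ :=
  ∑ s ∈ Icc 1 t, (y s / estM P πh i (k s) * rLow P πh i (k s) (cx s) (av s) -
    termMean E P πh i (k s) / estM P πh i (k s))

/-- Dividing by the constant `maxRatio` puts all weights in `[0,1]`, since `0 < rLow ≤ rUp`, so
Azuma–Hoeffding applies. No clipping indicator, whose level depends on the whole history, enters
this sum. -/
theorem Regular.measure_centredSum_le (R : Regular E P πh) (H : IsRun E P πh μ ℱ k cx av y)
    [IsProbabilityMeasure μ] [Nonempty X] [Nonempty V] (i : Fin N) {σ : ℝ} (hσ : |σ| = 1) {t : ℕ}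
    (ht : 2 ≤ t) :
    μ.real {ω | maxRatio P πh i * (8 * √(t * Real.log t)) ≤ σ * centredSum E P πh (fun s => k s ω)
      (fun s => cx s ω) (fun s => av s ω) (fun s => y s ω) i t} ≤ 1 / (t : ℝ) ^ 2 := by
  set L := maxRatio P πh i with hL
  have hL0 : 0 < L := R.maxRatio_pos i
  set c : Fin N → X → V → ℝ := fun j x a => rLow P πh i j x a / (estM P πh i j * L) with hc
  have hc0 : ∀ j x a, 0 ≤ c j x a := fun j x a =>
    div_nonneg (R.rLow_pos i j x a).le (mul_nonneg (R.estM_pos i j).le hL0.le)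
  have hc1 : ∀ j x a, c j x a ≤ 1 := by
    intro j x a
    have hm := R.estM_pos i j
    have h1 := rUp_div_le_maxRatio (P := P) (πh := πh) i j x a
    rw [div_le_iff₀ hm] at h1
    have h2 := R.rUp_sub_rLow i j x a
    have h3 := R.width_nonneg
    refine div_le_one_of_le₀ ?_ (by positivity)
    linarith
  set W : ℕ → Ω → ℝ := fun s ω => c (k s ω) (cx s ω) (av s ω) * y s ω with hWdef
  set g : ℕ → Ω → ℝ := fun s ω =>
    E.expect (k s ω) fun x a => c (k s ω) x a * E.rewardMean x a with hgdef
  have key := measure_deviation_le (μ := μ) (ℱ := ℱ) (W := W) (g := g)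
    (fun s => (H.measurable_weight s c).mul (H.reward_adapted s))
    (fun s => H.measurable_expert s fun j => E.expect j fun x a => c j x a * E.rewardMean x a)
    (fun s => by
      filter_upwards [H.reward_mem s] with ω hω
      exact ⟨mul_nonneg (hc0 _ _ _) hω.1, mul_le_one₀ (hc1 _ _ _) hω.1 hω.2⟩)
    (fun s ω => by
      constructor
      · rw [← E.expect_const (k (s + 1) ω) 0]
        exact E.expect_mono _ fun x a => mul_nonneg (hc0 _ _ _) (E.rewardMean_nonneg x a)
      · rw [← E.expect_const (k (s + 1) ω) 1]
        exact E.expect_mono _ fun x a => mul_le_one₀ (hc1 _ _ _) (E.rewardMean_nonneg x a)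
          (E.rewardMean_le_one x a))
    (fun s => H.condExp_weighted_reward s c) hσ ht
  refine le_trans (le_of_eq ?_) key
  congr 1
  ext ω
  have hg : ∀ s, g s ω = termMean E P πh i (k s ω) / estM P πh i (k s ω) / L := by
    intro s
    have hm := (R.estM_pos i (k s ω)).ne'
    simp only [hgdef, hc, termMean, Environment.expect, Finset.sum_div, Finset.mul_sum]
    refine Finset.sum_congr rfl fun x _ => Finset.sum_congr rfl fun a _ => ?_
    field_simp
  have hW : ∀ s, W s ω = y s ω / estM P πh i (k s ω) *
      rLow P πh i (k s ω) (cx s ω) (av s ω) / L := by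
    intro s
    have hm := (R.estM_pos i (k s ω)).ne'
    simp only [hWdef, hc]
    field_simp
  have hsum : ∑ s ∈ Icc 1 t, (W s ω - g s ω) = centredSum E P πh (fun s => k s ω)
      (fun s => cx s ω) (fun s => av s ω) (fun s => y s ω) i t / L := by
    unfold centredSum
    rw [Finset.sum_div]
    refine Finset.sum_congr rfl fun s _ => ?_
    rw [hg, hW, sub_div]
  rw [Set.mem_ofPred_eq, Set.mem_ofPred_eq, hsum, ← mul_div_assoc, le_div_iff₀ hL0, mul_comm L]

namespace Regular

variable (R : Regular E P πh)
include R

/-- The estimator undershoots by less than `width + ε/2`, which the bonus `3/2 ε + width` covers. -/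
theorem lt_ucb [Nonempty X] [Nonempty V] {t : ℕ} (ht : t ∈ clipTimes P πh) (k : ℕ → Fin N)
    (cx : ℕ → X) (av : ℕ → V) (y : ℕ → ℝ) (i : Fin N)
    (h : -centredSum E P πh k cx av y i t < maxRatio P πh i * (8 * √(t * Real.log t))) :
    E.mean i < ucb P πh k cx av y i t := by
  have hZ := R.Z_pos k i ht.1
  have hdev := R.maxRatio_mul_le ht k i
  have heps := R.eps_pos k i ht.1
  have hmean : (E.mean i - P.width) * Z P πh k i t ≤
      ∑ s ∈ Icc 1 t, termMean E P πh i (k s) / estM P πh i (k s) := by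
    unfold Z
    rw [Finset.mul_sum]
    refine Finset.sum_le_sum fun s _ => ?_
    exact mul_le_mul_of_nonneg_right (R.expect_rLow_mem i (k s)).1
      (inv_nonneg.2 (R.estM_pos i (k s)).le)
  unfold centredSum at h
  rw [Finset.sum_sub_distrib] at h
  have hY : E.mean i - P.width - eps P πh k i t / 2 < estY P πh k cx av y i t := by
    rw [estY_eq_of_mem_clipTimes ht, inv_mul_eq_div, lt_div_iff₀ hZ]
    linarith
  unfold ucb
  rw [R.err_eq_width ht]
  linarith

/-- Since `rLow` is below the true ratio, the conditional means never exceed `μ_i`; the width enters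
only once, through `err`. -/
theorem ucb_lt [Nonempty X] [Nonempty V] {t : ℕ} (ht : t ∈ clipTimes P πh) (k : ℕ → Fin N)
    (cx : ℕ → X) (av : ℕ → V) (y : ℕ → ℝ) (i : Fin N)
    (h : centredSum E P πh k cx av y i t < maxRatio P πh i * (8 * √(t * Real.log t))) :
    ucb P πh k cx av y i t < E.mean i + 2 * eps P πh k i t + P.width := by
  have hZ := R.Z_pos k i ht.1
  have hdev := R.maxRatio_mul_le ht k i
  have hmean : ∑ s ∈ Icc 1 t, termMean E P πh i (k s) / estM P πh i (k s) ≤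
      E.mean i * Z P πh k i t := by
    unfold Z
    rw [Finset.mul_sum]
    refine Finset.sum_le_sum fun s _ => ?_
    exact mul_le_mul_of_nonneg_right (R.expect_rLow_mem i (k s)).2
      (inv_nonneg.2 (R.estM_pos i (k s)).le)
  unfold centredSum at h
  rw [Finset.sum_sub_distrib] at h
  have hY : estY P πh k cx av y i t < E.mean i + eps P πh k i t / 2 := by
    rw [estY_eq_of_mem_clipTimes ht, inv_mul_eq_div, div_lt_iff₀ hZ]
    linarith
  unfold ucb
  rw [R.err_eq_width ht]
  linarith

/-- After the clipping time and the time `τ_j`, a suboptimal expert `j` is played in round `t + 1`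
with probability at most `2 / t²`. -/
theorem measure_expert_le (H : IsRun E P πh μ ℱ k cx av y)
    [IsProbabilityMeasure μ] [Nonempty X] [Nonempty V] (i j : Fin N) {t : ℕ}
    (ht : t ∈ clipTimes P πh) (hD : 0 < E.mean i - E.mean j - P.γ * P.pV)
    (hτ : t ∈ tauTimes P (E.mean i - E.mean j)) :
    μ.real {ω | k (t + 1) ω = j} ≤ 2 / (t : ℝ) ^ 2 := by
  have h1 := R.measure_centredSum_le H i (σ := -1) (by norm_num) ht.1
  have h2 := R.measure_centredSum_le H j (σ := 1) (by norm_num) ht.1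
  set S₁ := {ω | maxRatio P πh i * (8 * √(t * Real.log t)) ≤ -1 * centredSum E P πh
    (fun s => k s ω) (fun s => cx s ω) (fun s => av s ω) (fun s => y s ω) i t} with hS₁
  set S₂ := {ω | maxRatio P πh j * (8 * √(t * Real.log t)) ≤ 1 * centredSum E P πh
    (fun s => k s ω) (fun s => cx s ω) (fun s => av s ω) (fun s => y s ω) j t} with hS₂
  -- Off both events the index of `j` is below `μ_j + 3/4 (Δ - γ pV) + γ pV / 2 < μ_i`, below the
  -- index of `i`.
  have hsub : {ω | k (t + 1) ω = j} ⊆ S₁ ∪ S₂ := by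
    intro ω hω
    by_contra hn
    rw [Set.mem_union, not_or, hS₁, hS₂, Set.mem_ofPred_eq, Set.mem_ofPred_eq, not_le, not_le,
      neg_one_mul, one_mul] at hn
    have hi := R.lt_ucb ht _ _ _ _ i hn.1
    have hj := R.ucb_lt ht _ _ _ _ j hn.2
    have hD1 : E.mean i - E.mean j - P.γ * P.pV ≤ 1 := by
      linarith [E.mean_le_one i, E.mean_nonneg j, mul_pos R.γ_pos R.pV_pos]
    have heps := R.eps_le_of_mem_tauTimes hD hD1 hτ (fun s => k s ω) j
    have hmax := H.expert_argmax t (by have := ht.1; omega) ω i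
    have hω' : k (t + 1) ω = j := hω
    rw [hω'] at hmax
    linarith [R.width_le', mul_pos R.γ_pos R.pV_pos]
  calc μ.real {ω | k (t + 1) ω = j} ≤ μ.real (S₁ ∪ S₂) := measureReal_mono hsub
    _ ≤ μ.real S₁ + μ.real S₂ := measureReal_union_le _ _
    _ ≤ 2 / (t : ℝ) ^ 2 := by linarith [add_div (1 : ℝ) 1 ((t : ℝ) ^ 2)]

end Regular

end EDUCB
end

/-! ### Abel summation of the regret over layers. -/

noncomputable section

namespace EDUCB

section Layers

variable {m : ℕ}

/-- The time-dependent part of the regret bound after summation by parts. -/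
def layered (Δ τ : Fin (m + 2) → ℝ) : ℝ :=
  τ 1 * Δ 1 + ∑ k : Fin m, τ k.succ.succ * (Δ k.succ.succ - Δ k.succ.castSucc)

theorem sum_sub_castSucc (f : Fin (m + 2) → ℝ) :
    ∑ k : Fin m, (f k.succ.succ - f k.succ.castSucc) = f (Fin.last (m + 1)) - f 1 := by
  have h1 := Fin.sum_univ_succ fun k : Fin (m + 1) => f k.succ
  have h2 := Fin.sum_univ_castSucc fun k : Fin (m + 1) => f k.succ
  simp only [Fin.succ_zero_eq_one, Fin.succ_last] at h1 h2
  rw [Finset.sum_sub_distrib]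
  simp only [← Fin.succ_castSucc] at *
  linarith

/-- In the summed-by-parts form the times are multiplied by nonnegative gap increments, so the bound
is monotone in the times. -/
theorem regretBound_eq (Δ : Fin (m + 2) → ℝ) (T : Fin (m + 2) → ℕ) :
    regretBound Δ T =
      Real.pi ^ 2 / 3 * ∑ k : Fin (m + 1), Δ k.succ + layered Δ fun i => (T i : ℝ) := by
  have h := sum_sub_castSucc fun i => (T i : ℝ) * Δ i
  have h' : ∑ k : Fin m, (T k.succ.succ : ℝ) * (Δ k.succ.succ - Δ k.succ.castSucc) =
      ∑ k : Fin m, ((T k.succ.succ : ℝ) * Δ k.succ.succ - T k.succ.castSucc * Δ k.succ.castSucc) +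
      ∑ k : Fin m, ((T k.succ.castSucc : ℝ) - T k.succ.succ) * Δ k.succ.castSucc := by
    rw [← Finset.sum_add_distrib]
    exact Finset.sum_congr rfl fun k _ => by ring
  unfold regretBound layered
  rw [h', h]
  ring

theorem layered_const (Δ : Fin (m + 2) → ℝ) (c : ℝ) :
    layered Δ (fun _ => c) = c * Δ (Fin.last (m + 1)) := by
  unfold layered
  rw [← Finset.mul_sum, sum_sub_castSucc]
  ring

theorem layered_sum {ι : Type*} (s : Finset ι) (Δ : Fin (m + 2) → ℝ) (f : ι → Fin (m + 2) → ℝ) :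
    layered Δ (fun i => ∑ t ∈ s, f t i) = ∑ t ∈ s, layered Δ (f t) := by
  unfold layered
  rw [Finset.sum_add_distrib, Finset.sum_comm]
  simp only [Finset.sum_mul]

theorem layered_mono {Δ τ τ' : Fin (m + 2) → ℝ} (hΔ : Monotone Δ) (h0 : 0 ≤ Δ 1)
    (h : ∀ i, i ≠ 0 → τ i ≤ τ' i) : layered Δ τ ≤ layered Δ τ' := by
  unfold layered
  refine add_le_add (mul_le_mul_of_nonneg_right (h 1 (by simp)) h0)
    (Finset.sum_le_sum fun k _ => ?_)
  refine mul_le_mul_of_nonneg_right (h _ (Fin.succ_ne_zero _)) (sub_nonneg.2 (hΔ ?_))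
  exact (Fin.castSucc_lt_succ (i := k.succ)).le

/-- Truncate the gaps at `Δ j`: their increments telescope to `Δ j`, those up to `j` carry
coefficients at least `1`, and the later ones vanish. -/
theorem le_layered {Δ τ : Fin (m + 2) → ℝ} (hΔ : Monotone Δ) (h0 : 0 ≤ Δ 1) {j : Fin (m + 2)}
    (hj : j ≠ 0) (hτ : ∀ i, i ≠ 0 → 0 ≤ τ i) (hτj : ∀ i, i ≠ 0 → i ≤ j → 1 ≤ τ i) :
    Δ j ≤ layered Δ τ := by
  have h1 : (1 : Fin (m + 2)) ≤ j := Fin.one_le_of_ne_zero hj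
  have h := layered_const (fun i => min (Δ i) (Δ j)) 1
  rw [one_mul, min_eq_right (hΔ (Fin.le_last j))] at h
  rw [← h]
  unfold layered
  refine add_le_add ?_ (Finset.sum_le_sum fun k _ => ?_)
  · rw [one_mul]
    exact (min_le_left _ _).trans (le_mul_of_one_le_left h0 (hτj 1 (by simp) h1))
  · have hk : Δ k.succ.castSucc ≤ Δ k.succ.succ :=
      hΔ (Fin.castSucc_lt_succ (i := k.succ)).le
    have hk0 : k.succ.succ ≠ 0 := Fin.succ_ne_zero _
    rw [one_mul]
    change min (Δ k.succ.succ) (Δ j) - min (Δ k.succ.castSucc) (Δ j) ≤ _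
    rcases le_or_gt k.succ.succ j with hkj | hkj
    · rw [min_eq_left (hΔ hkj), min_eq_left (hk.trans (hΔ hkj))]
      exact le_mul_of_one_le_left (sub_nonneg.2 hk) (hτj _ hk0 hkj)
    · have hjk : j ≤ k.succ.castSucc := Fin.le_castSucc_iff.2 hkj
      rw [min_eq_right (hΔ hjk), min_eq_right (hΔ hkj.le), sub_self]
      exact mul_nonneg (hτ _ hk0) (sub_nonneg.2 hk)

end Layers

theorem sum_two_div_sq_le (s : Finset ℕ) : ∑ t ∈ s, 2 / (t : ℝ) ^ 2 ≤ Real.pi ^ 2 / 3 := by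
  have h := sum_le_hasSum s (fun t _ => by positivity) hasSum_zeta_two
  have h2 : ∑ t ∈ s, 2 / (t : ℝ) ^ 2 = 2 * ∑ t ∈ s, 1 / (t : ℝ) ^ 2 := by
    rw [Finset.mul_sum]
    exact Finset.sum_congr rfl fun t _ => by ring
  rw [h2]
  linarith

/-! ### The regret bound, and its dependence on the parameters. -/

section Regret

variable {m : ℕ} {X : Type u} {V : Type v} [Fintype X] [Fintype V]
  {E : Environment (m + 2) X V} {P : Params} {πh : Fin (m + 2) → X → V → ℝ}

theorem Environment.gap_zero (E : Environment (m + 2) X V) : E.gap 0 = 0 := sub_self _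

theorem Environment.gap_monotone (hanti : Antitone E.mean) : Monotone E.gap :=
  fun _ _ h => sub_le_sub_left (hanti h) _

theorem Environment.gap_le_one (E : Environment (m + 2) X V) (j : Fin (m + 2)) : E.gap j ≤ 1 := by
  unfold Environment.gap
  linarith [E.mean_le_one 0, E.mean_nonneg j]

namespace Regular

variable (R : Regular E P πh)
include R

theorem mem_of_Tsub_le {Δ : ℝ} (hD : 0 < Δ - P.γ * P.pV) (hD1 : Δ - P.γ * P.pV ≤ 1)
    (hclip : (clipTimes P πh).Nonempty) (hτ₁ : (tau1Times P).Nonempty)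
    (hτ : (tauTimes P Δ).Nonempty) {t : ℕ} (ht : Tsub P πh Δ ≤ t) :
    t ∈ clipTimes P πh ∧ t ∈ tauTimes P Δ := by
  obtain ⟨h1, h2⟩ := max_le_iff.1 ht
  obtain ⟨h3, h4⟩ := max_le_iff.1 h1
  have h5 := (R.four_le_of_mem_tau1Times (Nat.sInf_mem hτ₁)).trans h4
  exact ⟨R.mem_clipTimes_of_le (Nat.sInf_mem hclip) h3 h5,
    R.mem_tauTimes_of_le hD hD1 (Nat.sInf_mem hτ) h2 h5⟩

theorem Tsub_antitone {Δ Δ' : ℝ} (hD : 0 < Δ - P.γ * P.pV) (hΔ : Δ ≤ Δ')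
    (hD1 : Δ' - P.γ * P.pV ≤ 1) (hτ : (tauTimes P Δ).Nonempty) :
    Tsub P πh Δ' ≤ Tsub P πh Δ :=
  max_le_max le_rfl (Nat.sInf_le (R.tauTimes_subset hD hΔ hD1 (Nat.sInf_mem hτ)))

/-- The regret bound, for every horizon. -/
theorem integral_regret_le (hanti : Antitone E.mean) (hgap : P.γ * P.pV < E.gap 1)
    (hclip : (clipTimes P πh).Nonempty) (hτ₁ : (tau1Times P).Nonempty)
    (hτ : ∀ i : Fin (m + 2), i ≠ 0 → (tauTimes P (E.gap i)).Nonempty)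
    [Nonempty X] [Nonempty V]
    {Ω : Type z} {mΩ : MeasurableSpace Ω} {μ : Measure Ω} [IsProbabilityMeasure μ]
    {ℱ : Filtration ℕ mΩ} {k : ℕ → Ω → Fin (m + 2)} {cx : ℕ → Ω → X} {av : ℕ → Ω → V}
    {y : ℕ → Ω → ℝ} (H : IsRun E P πh μ ℱ k cx av y) (T : ℕ) :
    ∫ ω, ∑ t ∈ Finset.Icc 1 T, (E.mean 0 - E.mean (k t ω)) ∂μ ≤
      regretBound E.gap fun i => Tsub P πh (E.gap i) := by
  classical
  have hmono := Environment.gap_monotone hanti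
  have hγp : 0 < P.γ * P.pV := mul_pos R.γ_pos R.pV_pos
  have hgap1 : 0 ≤ E.gap 1 := by linarith
  have hD : ∀ i : Fin (m + 2), i ≠ 0 → 0 < E.gap i - P.γ * P.pV := fun i hi => by
    linarith [hmono (Fin.one_le_of_ne_zero hi)]
  have hD1 : ∀ i : Fin (m + 2), E.gap i - P.γ * P.pV ≤ 1 := fun i => by
    linarith [E.gap_le_one i]
  set τ : Fin (m + 2) → ℕ := fun i => Tsub P πh (E.gap i) with hτdef
  have hτanti : ∀ i j : Fin (m + 2), i ≠ 0 → i ≤ j → τ j ≤ τ i := fun i j hi hij =>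
    R.Tsub_antitone (hD i hi) (hmono hij) (hD1 j) (hτ i hi)
  -- A play of `i` in round `t ≤ τ i` is charged to `lay t`: by antitonicity the smaller gaps are
  -- also still active, so `lay t` is at least that gap. Other suboptimal plays are charged to
  -- `late`.
  set lay : ℕ → ℝ := fun t => layered E.gap fun i => if t ≤ τ i then 1 else 0 with hlay
  set late : ℕ → Fin (m + 1) → Ω → ℝ := fun t j =>
    ({ω | τ j.succ < t ∧ k t ω = j.succ}).indicator fun _ => E.gap j.succ with hlate
  have hgap0 : ∀ j : Fin (m + 1), 0 ≤ E.gap j.succ := fun j => by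
    linarith [hD j.succ (Fin.succ_ne_zero j)]
  have hlate0 : ∀ t j ω, 0 ≤ late t j ω := fun t j ω =>
    Set.indicator_nonneg (fun _ _ => hgap0 j) ω
  have hlay0 : ∀ t, 0 ≤ lay t := fun t => by
    have h := layered_const E.gap 0
    rw [zero_mul] at h
    rw [← h]
    exact layered_mono hmono hgap1 fun i _ => by split_ifs <;> norm_num
  have hpoint : ∀ t ω, E.mean 0 - E.mean (k t ω) ≤ lay t + ∑ j, late t j ω := by
    intro t ω
    have hs : 0 ≤ ∑ j, late t j ω := Finset.sum_nonneg fun j _ => hlate0 t j ω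
    change E.gap (k t ω) ≤ _
    rcases eq_or_ne (k t ω) 0 with h0 | h0
    · rw [h0, Environment.gap_zero]
      linarith [hlay0 t]
    · rcases le_or_gt t (τ (k t ω)) with ht | ht
      · have : E.gap (k t ω) ≤ lay t := by
          refine le_layered hmono hgap1 h0 (fun i _ => by split_ifs <;> norm_num) ?_
          intro i hi hij
          rw [if_pos (ht.trans (hτanti i _ hi hij))]
        linarith
      · obtain ⟨j, hj⟩ := Fin.exists_succ_eq.2 h0
        have h1 : late t j ω = E.gap (k t ω) := by
          have : ω ∈ {ω | τ j.succ < t ∧ k t ω = j.succ} := ⟨by rw [hj]; exact ht, hj.symm⟩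
          simp only [hlate]
          rw [Set.indicator_of_mem this, hj]
        have h2 := Finset.single_le_sum (f := fun j => late t j ω)
          (fun j _ => hlate0 t j ω) (Finset.mem_univ j)
        linarith [hlay0 t]
  have hmeas : ∀ t j, 1 ≤ t → MeasurableSet {ω | τ j < t ∧ k t ω = j} := by
    intro t j ht
    obtain ⟨s, rfl⟩ := Nat.exists_eq_add_of_le' ht
    exact (MeasurableSet.const _).inter (ℱ.le s _ (H.expert_predictable s j))
  have hlateint : ∀ t j, 1 ≤ t → Integrable (late t j) μ := fun t j ht =>
    (integrable_const _).indicator (hmeas t j.succ ht)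
  have hlatele : ∀ s (j : Fin (m + 1)), ∫ ω, late (s + 1) j ω ∂μ ≤
      E.gap j.succ * (2 / (s : ℝ) ^ 2) := by
    intro s j
    rw [hlate, integral_indicator (hmeas _ _ (Nat.le_add_left 1 s)), setIntegral_const,
      smul_eq_mul, mul_comm]
    refine mul_le_mul_of_nonneg_left ?_ (hgap0 j)
    -- At `s = 0` the bound `2 / s²` is `0` by convention; this is consistent, since clip times are
    -- at least `2` and round `1` is never late.
    rcases le_or_gt (τ j.succ) s with hs | hs
    · have hj := Fin.succ_ne_zero j
      obtain ⟨h1, h2⟩ := R.mem_of_Tsub_le (hD _ hj) (hD1 _) hclip hτ₁ (hτ _ hj) hs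
      refine le_trans (measureReal_mono ?_) (R.measure_expert_le H 0 j.succ h1 (hD _ hj) h2)
      exact fun ω hω => hω.2
    · have : {ω | τ j.succ < s + 1 ∧ k (s + 1) ω = j.succ} = ∅ := by
        ext ω
        simp only [Set.mem_ofPred_eq, Set.mem_empty_iff_false, iff_false, not_and]
        intro h; omega
      rw [this, measureReal_empty]
      positivity
  have hgapint : ∀ t ∈ Icc 1 T, Integrable (fun ω => E.mean 0 - E.mean (k t ω)) μ := by
    intro t ht
    obtain ⟨s, rfl⟩ := Nat.exists_eq_add_of_le' (Finset.mem_Icc.1 ht).1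
    refine Integrable.of_bound ((H.measurable_expert s fun j => E.mean 0 - E.mean j).mono
      (ℱ.le s) le_rfl).aestronglyMeasurable 1 ?_
    filter_upwards with ω
    rw [Real.norm_eq_abs, abs_le]
    constructor <;> linarith [E.mean_nonneg 0, E.mean_le_one 0, E.mean_nonneg (k (s + 1) ω),
      E.mean_le_one (k (s + 1) ω)]
  have hround : ∀ t ∈ Icc 1 T, ∫ ω, (E.mean 0 - E.mean (k t ω)) ∂μ ≤
      lay t + ∑ j : Fin (m + 1), E.gap j.succ * (2 / ((t - 1 : ℕ) : ℝ) ^ 2) := by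
    intro t ht
    obtain ⟨s, rfl⟩ := Nat.exists_eq_add_of_le' (Finset.mem_Icc.1 ht).1
    have hsi : Integrable (fun ω => ∑ j, late (s + 1) j ω) μ :=
      integrable_finsetSum _ fun j _ => hlateint _ j (Nat.le_add_left 1 s)
    calc ∫ ω, (E.mean 0 - E.mean (k (s + 1) ω)) ∂μ
        ≤ ∫ ω, (lay (s + 1) + ∑ j, late (s + 1) j ω) ∂μ :=
          integral_mono (hgapint _ ht) ((integrable_const _).add hsi) fun ω => hpoint _ ω
      _ = lay (s + 1) + ∑ j, ∫ ω, late (s + 1) j ω ∂μ := by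
          rw [integral_add (integrable_const _) hsi,
            integral_finsetSum _ fun j _ => hlateint _ j (Nat.le_add_left 1 s)]
          simp
      _ ≤ _ := by
          rw [Nat.add_sub_cancel]
          gcongr with j
          exact hlatele s j
  rw [integral_finsetSum _ hgapint, regretBound_eq]
  refine (Finset.sum_le_sum hround).trans ?_
  rw [Finset.sum_add_distrib, add_comm]
  refine add_le_add ?_ ?_
  · rw [Finset.sum_comm, Finset.mul_sum]
    refine Finset.sum_le_sum fun j _ => ?_
    rw [← Finset.mul_sum, mul_comm]
    refine mul_le_mul_of_nonneg_right ?_ (hgap0 j)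
    -- Round `t` is decided by the index at `t - 1`, so the series is shifted by one.
    have hinj : Set.InjOn (fun t : ℕ => t - 1) (Icc 1 T : Finset ℕ) := by
      intro a ha b hb hab
      have h1 := (Finset.mem_Icc.1 (Finset.mem_coe.1 ha)).1
      have h2 := (Finset.mem_Icc.1 (Finset.mem_coe.1 hb)).1
      simp only at hab
      omega
    have := sum_two_div_sq_le ((Icc 1 T).image fun t => t - 1)
    rwa [Finset.sum_image hinj] at this
  · rw [hlay, ← layered_sum]
    refine layered_mono hmono hgap1 fun i _ => ?_
    rw [Finset.sum_boole]
    have hsub : (Icc 1 T).filter (fun t => t ≤ τ i) ⊆ Icc 1 (τ i) := by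
      intro t ht
      simp only [Finset.mem_filter, Finset.mem_Icc] at ht ⊢
      omega
    have hcard := Finset.card_le_card hsub
    rw [Nat.card_Icc, Nat.add_sub_cancel] at hcard
    exact_mod_cast hcard

/-- The regret bound is at most linear in the number of experts, given a common bound on the
times. -/
theorem regretBound_le (hanti : Antitone E.mean) (hgap : P.γ * P.pV < E.gap 1) {t₀ : ℕ}
    (hclip : t₀ ∈ clipTimes P πh) (hτ₁ : t₀ ∈ tau1Times P)
    (hτ : ∀ i : Fin (m + 2), i ≠ 0 → t₀ ∈ tauTimes P (E.gap i)) :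
    regretBound E.gap (fun i => Tsub P πh (E.gap i)) ≤
      (Real.pi ^ 2 / 3 + t₀) * ((m + 2 : ℕ) : ℝ) := by
  have hmono := Environment.gap_monotone hanti
  have hgap1 : 0 ≤ E.gap 1 := by linarith [mul_pos R.γ_pos R.pV_pos]
  have hsum : ∑ j : Fin (m + 1), E.gap j.succ ≤ (m + 2 : ℕ) := by
    calc ∑ j : Fin (m + 1), E.gap j.succ ≤ ∑ _j : Fin (m + 1), (1 : ℝ) :=
          Finset.sum_le_sum fun j _ => E.gap_le_one _
      _ ≤ (m + 2 : ℕ) := by simp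
  have hlay : layered E.gap (fun i => (Tsub P πh (E.gap i) : ℝ)) ≤ t₀ * ((m + 2 : ℕ) : ℝ) := by
    refine (layered_mono (τ' := fun _ => (t₀ : ℝ)) hmono hgap1 fun i hi => ?_).trans ?_
    · exact_mod_cast max_le (max_le (Nat.sInf_le hclip) (Nat.sInf_le hτ₁)) (Nat.sInf_le (hτ i hi))
    · rw [layered_const]
      have h2 : (1 : ℝ) ≤ ((m + 2 : ℕ) : ℝ) := by exact_mod_cast (by omega : 1 ≤ m + 2)
      exact mul_le_mul_of_nonneg_left ((E.gap_le_one _).trans h2) (Nat.cast_nonneg _)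
  rw [regretBound_eq, add_mul]
  gcongr

end Regular

/-- A time, depending on the parameters only, that satisfies the conditions defining all times. -/
theorem exists_uniform_time {pV γ M C D : ℝ} (hγ : 0 < γ) (hγ1 : γ ≤ 1)
    (hM : 1 ≤ M) (hC : 32 ≤ C) (hD : 0 < D) (hD1 : D ≤ 1) (hpV : 0 < pV) :
    ∃ t : ℕ, 4 ≤ t ∧ √(Real.log t / t) ≤ γ / C / Real.log (2 / (γ / C)) ∧
      √(Real.log t / t) ≤ D / (3 * C * M * Real.log (6 * C / D)) ∧
      ∀ y, y = 2 * Real.exp (-(4 * (1 / pV + 1))) / C →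
        9 / 8 * M * √(Real.log t / t) ≤ y / Real.log (2 / y) := by
  have hC0 : 0 < C := by linarith
  have hM0 : 0 < M := by linarith
  have h1 : 0 < γ / C / Real.log (2 / (γ / C)) := by
    have h := div_pos hγ hC0
    exact div_pos h (log_two_div_pos h (by rw [div_lt_iff₀ hC0]; linarith))
  have h2 : 0 < D / (3 * C * M * Real.log (6 * C / D)) := by
    have := Real.log_pos ((one_lt_div hD).2 (by linarith : D < 6 * C))
    positivity
  set y := 2 * Real.exp (-(4 * (1 / pV + 1))) / C with hy
  have h3 : 0 < y / Real.log (2 / y) := by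
    have hy0 : 0 < y := by positivity
    have hexp : Real.exp (-(4 * (1 / pV + 1))) ≤ 1 := Real.exp_le_one_iff.2 (by
      have : 0 < 1 / pV := by positivity
      linarith)
    exact div_pos hy0 (log_two_div_pos hy0 (by rw [hy, div_lt_iff₀ hC0]; linarith))
  have h3' : 0 < y / Real.log (2 / y) / (9 / 8 * M) := by positivity
  obtain ⟨t, ht, hle⟩ := exists_sqrt_log_div_le (lt_min h1 (lt_min h2 h3'))
  obtain ⟨ha, hb⟩ := le_min_iff.1 hle
  obtain ⟨hb, hc⟩ := le_min_iff.1 hb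
  refine ⟨t, ht, ha, hb, ?_⟩
  rintro _ rfl
  rw [le_div_iff₀ (by positivity)] at hc
  linarith

/-- The two assumptions on the accuracy `ξ` force it to be small compared with `p_V`. -/
theorem accuracy_le {pV γ ξ : ℝ} (hpV : 0 < pV) (hpV2 : pV ≤ 1 / 2) (hγ : 0 < γ) (hγ1 : γ ≤ 1)
    (hξ0 : 0 ≤ ξ) (h1 : ξ ≤ 2 * ((√(1 + pV ^ 4 * γ ^ 2) - 1) / (pV * γ)))
    (h2 : ξ / pV * (1 / (pV - ξ) + 1 / (pV + ξ)) ≤ γ * pV / 2) : ξ ≤ pV / 16 := by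
  have hpγ : pV * γ ≤ pV := mul_le_of_le_one_right hpV.le hγ1
  have hsq : pV ^ 2 ≤ 1 / 4 := by nlinarith
  have hlt : ξ < pV := by
    -- `√(1 + u) ≤ 1 + u/2` turns the first assumption into `ξ ≤ pV³ γ < pV`, so the denominators in
    -- the second are positive.
    have hs := Real.sqrt_one_add_le (x := pV ^ 4 * γ ^ 2) (by nlinarith [sq_nonneg (pV ^ 2 * γ)])
    have h3 : 2 * ((√(1 + pV ^ 4 * γ ^ 2) - 1) / (pV * γ)) ≤ pV ^ 2 * (pV * γ) := by
      rw [← mul_div_assoc, div_le_iff₀ (by positivity)]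
      nlinarith
    nlinarith [mul_pos hpV hγ]
  have hpos : 0 < pV - ξ := by linarith
  -- The bracket is at least its value `2 / pV` at `ξ = 0`, so the second assumption gives `ξ ≤ γ
  -- pV³ / 4 ≤ pV / 16`.
  have h4 : ξ * 2 / pV ^ 2 ≤ ξ / pV * (1 / (pV - ξ) + 1 / (pV + ξ)) := by
    have e : ξ / pV * (1 / (pV - ξ) + 1 / (pV + ξ)) = ξ * 2 / (pV ^ 2 - ξ ^ 2) := by
      have : pV ^ 2 - ξ ^ 2 ≠ 0 := by nlinarith
      field_simp
      ring
    rw [e]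
    have : 0 < pV ^ 2 - ξ ^ 2 := by nlinarith
    gcongr
    nlinarith [sq_nonneg ξ]
  have h5 := h4.trans h2
  rw [div_le_iff₀ (by positivity)] at h5
  nlinarith [mul_pos hpV hγ]

/-- This forces `1 ≤ M`. -/
theorem Environment.trueM_self {N : ℕ} (E : Environment N X V)
    (hpos : ∀ i x a, 0 < E.policy i x a) (i : Fin N) : E.trueM i i = 1 := by
  have : E.trueD i i = 0 := by
    refine Finset.sum_eq_zero fun x _ => mul_eq_zero_of_right _ (Finset.sum_eq_zero fun a _ => ?_)
    simp [div_self (hpos i x a).ne', f₁]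
  simp [Environment.trueM, this]

theorem Environment.nonempty_context {N : ℕ} (E : Environment N X V) : Nonempty X := by
  by_contra h
  rw [not_nonempty_iff] at h
  have := E.ctxLaw_sum
  simp at this

/-- Experts with different means must have at least two actions. -/
theorem Environment.nontrivial_action {N : ℕ} (E : Environment N X V) {i j : Fin N}
    (h : E.mean i ≠ E.mean j) : Nontrivial V := by
  by_contra hn
  rw [not_nontrivial_iff_subsingleton] at hn
  have h1 : ∀ i x a, E.policy i x a = 1 := fun i x a => by
    rw [← E.policy_sum i x, Fintype.sum_subsingleton _ a]
  exact h (by simp only [Environment.mean, h1])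

theorem Environment.policy_le {N : ℕ} (E : Environment N X V) [Nontrivial V] {p : ℝ}
    (hp : ∀ i x a, p ≤ E.policy i x a) (i : Fin N) (x : X) (a : V) : E.policy i x a ≤ 1 - p := by
  classical
  obtain ⟨b, hb⟩ := exists_ne a
  have h := Finset.sum_le_sum_of_subset_of_nonneg (Finset.subset_univ {a, b})
    fun c _ _ => E.policy_nonneg i x c
  rw [Finset.sum_pair hb.symm, E.policy_sum] at h
  linarith [hp i x b]

end Regret

end EDUCB
end

theorem theorem2 (pX pV γ M Δ₂ : ℝ) (hpX : 0 < pX) (hpV : 0 < pV) (hγ : 0 < γ)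
    (hΔ₂ : γ * pV < Δ₂) :
    ∃ C₁ : ℝ, ∀ (m : ℕ) (X : Type u) (V : Type v) [Fintype X] [Fintype V]
      (E : EDUCB.Environment (m + 2) X V),
      (∀ x, pX ≤ E.ctxLaw x) →
      (∀ i x a, pV ≤ E.policy i x a) →
      (∀ i, γ ≤ E.mean i) →
      (∀ i j, E.trueM i j ≤ M) →
      Antitone E.mean →
      E.gap 1 = Δ₂ →
      ∀ (ξ δ : ℝ),
      ξ ≤ 2 * ((√(1 + pV ^ 4 * γ ^ 2) - 1) / (pV * γ)) →
      ξ / pV * (1 / (pV - ξ) + 1 / (pV + ξ)) ≤ γ * pV / 2 →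
      ∀ (Ω₀ : Type w) [MeasurableSpace Ω₀] (P₀ : MeasureTheory.Measure Ω₀)
        [MeasureTheory.IsProbabilityMeasure P₀] (πh : Ω₀ → Fin (m + 2) → X → V → ℝ),
      EDUCB.IsApproxExperts E ξ δ P₀ πh →
      let P : EDUCB.Params := ⟨pX, pV, γ, ξ, M⟩
      let Tk : Ω₀ → Fin (m + 2) → ℕ := fun ω₀ i => EDUCB.Tsub P (πh ω₀) (E.gap i)
      ENNReal.ofReal (1 - δ) ≤ P₀ {ω₀ |
        -- the times `T_clip`, `τ_1`, `τ_2`, …, `τ_N` exist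
        ((EDUCB.clipTimes P (πh ω₀)).Nonempty ∧ (EDUCB.tau1Times P).Nonempty ∧
          ∀ i : Fin (m + 2), i ≠ 0 → (EDUCB.tauTimes P (E.gap i)).Nonempty) ∧
        -- the regret bound is at most `C₁ N`
        EDUCB.regretBound E.gap (Tk ω₀) ≤ C₁ * ((m + 2 : ℕ) : ℝ) ∧
        -- the expected cumulative regret is at most the regret bound, for all `T ≥ T_2`
        ∀ (Ω : Type z) [mΩ : MeasurableSpace Ω] (μ : MeasureTheory.Measure Ω)
          [MeasureTheory.IsProbabilityMeasure μ] (ℱ : MeasureTheory.Filtration ℕ mΩ)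
          (k : ℕ → Ω → Fin (m + 2)) (cx : ℕ → Ω → X) (av : ℕ → Ω → V) (y : ℕ → Ω → ℝ),
          EDUCB.IsRun E P (πh ω₀) μ ℱ k cx av y →
          ∀ T : ℕ, Tk ω₀ 1 ≤ T →
            ∫ ω, ∑ t ∈ Finset.Icc 1 T, (E.mean 0 - E.mean (k t ω)) ∂μ
              ≤ EDUCB.regretBound E.gap (Tk ω₀)} := by
  -- `t₀` must be fixed before the environment, while the inequalities on the parameters that it
  -- needs follow only from the environment. They appear as premises, and if they fail any value of
  -- `t₀` will do.
  have htime : ∃ t₀ : ℕ, γ ≤ 1 → 1 ≤ M → 32 ≤ 32 * M / (γ * (1 - pV)) → Δ₂ - γ * pV ≤ 1 →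
      4 ≤ t₀ ∧ √(Real.log t₀ / t₀) ≤ γ / (32 * M / (γ * (1 - pV))) /
        Real.log (2 / (γ / (32 * M / (γ * (1 - pV))))) ∧
      √(Real.log t₀ / t₀) ≤ (Δ₂ - γ * pV) / (3 * (32 * M / (γ * (1 - pV))) * M *
        Real.log (6 * (32 * M / (γ * (1 - pV))) / (Δ₂ - γ * pV))) ∧
      ∀ y, y = 2 * Real.exp (-(4 * (1 / pV + 1))) / (32 * M / (γ * (1 - pV))) →
        9 / 8 * M * √(Real.log t₀ / t₀) ≤ y / Real.log (2 / y) := by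
    by_cases h : γ ≤ 1 ∧ 1 ≤ M ∧ 32 ≤ 32 * M / (γ * (1 - pV)) ∧ Δ₂ - γ * pV ≤ 1
    · obtain ⟨t, ht⟩ := EDUCB.exists_uniform_time hγ h.1 h.2.1 h.2.2.1 (sub_pos.2 hΔ₂) h.2.2.2 hpV
      exact ⟨t, fun _ _ _ _ => ht⟩
    · exact ⟨0, fun h1 h2 h3 h4 => absurd ⟨h1, h2, h3, h4⟩ h⟩
  obtain ⟨t₀, ht₀⟩ := htime
  refine ⟨Real.pi ^ 2 / 3 + t₀, ?_⟩
  intro m X V _ _ E hctx hpol hmean hM hanti hgap ξ δ hξ hwidth Ω₀ _ P₀ _ πh happrox P Tk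
  -- Each accurate realization `ω₀` satisfies all the claims, so no further probability is lost.
  refine le_trans happrox (MeasureTheory.measure_mono fun ω₀ hω₀ => ?_)
  have hX : Nonempty X := E.nonempty_context
  have hne : E.mean 0 ≠ E.mean 1 := by
    intro h
    have : E.gap 1 = 0 := by rw [EDUCB.Environment.gap, h, sub_self]
    linarith [mul_pos hγ hpV]
  have hV : Nontrivial V := E.nontrivial_action hne
  have hpolle := E.policy_le hpol
  have hpV2 : pV ≤ 1 / 2 := by
    have x : X := hX.some
    obtain ⟨a, -⟩ := exists_pair_ne V
    linarith [hpol 0 x a, hpolle 0 x a]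
  have hγ1 : γ ≤ 1 := (hmean 0).trans (E.mean_le_one 0)
  have hM1 : 1 ≤ M := by
    rw [← E.trueM_self (fun i x a => hpV.trans_le (hpol i x a)) 0]
    exact hM 0 0
  have hξ0 : 0 ≤ ξ := by
    obtain ⟨a, -⟩ := exists_pair_ne V
    exact (abs_nonneg _).trans (hω₀ 0 hX.some a)
  have R : EDUCB.Regular E P (πh ω₀) :=
    { pX_pos := hpX
      pV_pos := hpV
      pV_le := hpV2
      γ_pos := hγ
      γ_le := hγ1
      M_ge := hM1
      ξ_nonneg := hξ0
      ξ_le := EDUCB.accuracy_le hpV hpV2 hγ hγ1 hξ0 hξ hwidth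
      width_le := hwidth
      ctx_ge := hctx
      policy_ge := hpol
      policy_le := hpolle
      trueM_le := hM
      approx := hω₀ }
  have hγp := mul_pos hγ hpV
  have hD1 : ∀ i, E.gap i - γ * pV ≤ 1 := fun i => by linarith [E.gap_le_one i]
  have hgap' : P.γ * P.pV < E.gap 1 := by rw [hgap]; exact hΔ₂
  obtain ⟨h4, h1, h2, h3⟩ := ht₀ hγ1 hM1 R.thirty_two_le_C (by rw [← hgap]; exact hD1 1)
  have hclip : t₀ ∈ EDUCB.clipTimes P (πh ω₀) := R.mem_clipTimes (by omega) rfl (h3 _ rfl)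
  have hτ₁ : t₀ ∈ EDUCB.tau1Times P := R.mem_tau1Times (by omega) h1
  have hτ : ∀ i : Fin (m + 2), i ≠ 0 → t₀ ∈ EDUCB.tauTimes P (E.gap i) := by
    intro i hi
    refine R.tauTimes_subset (Δ := Δ₂) (sub_pos.2 hΔ₂) ?_ (hD1 i) ?_
    · rw [← hgap]
      exact EDUCB.Environment.gap_monotone hanti (Fin.one_le_of_ne_zero hi)
    · exact (R.mem_tauTimes_iff (sub_pos.2 hΔ₂) (by rw [← hgap]; exact hD1 1)).2 ⟨by omega, h2⟩
  have hτ' : ∀ i : Fin (m + 2), i ≠ 0 → (EDUCB.tauTimes P (E.gap i)).Nonempty :=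
    fun i hi => ⟨t₀, hτ i hi⟩
  refine ⟨⟨⟨t₀, hclip⟩, ⟨t₀, hτ₁⟩, hτ'⟩, R.regretBound_le hanti hgap' hclip hτ₁ hτ, ?_⟩
  intro Ω _ μ _ ℱ k cx av y H T _
  exact R.integral_regret_le hanti hgap' ⟨t₀, hclip⟩ ⟨t₀, hτ₁⟩ hτ' H T
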